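/- Conventions. Partial functions on Baire space $\mathbb{N}^\mathbb{N}$ are computable in the sense of Type-2 computability. A represented space is a set $X$ with a partial surjection $\delta_X :\subseteq \mathbb{N}^{\mathbb{N}} \to X$. A realizer of a multivalued function $f : X \rightrightarrows Y$ is a partial function $F :\subseteq \mathbb{N}^{\mathbb{N}} \to \mathbb{N}^{\mathbb{N}}$ with $\delta_Y(F(p)) \in f(\delta_X(p))$ for all $p \in \operatorname{dom}(\delta_X)$, and $f$ is computable if it has a computable realizer. We write $f \leq_W g$ (Weihrauch reducibility) if there are computable partial functions $K, H$ on $\mathbb{N}^{\mathbb{N}}$ such that $p \mapsto K\langle p, G H(p)\rangle$ is a realizer of $f$ for every realizer $G$ of $g$; $\equiv_W$ and $<_W$ denote the corresponding equivalence and strict reducibility. An open subset of $\{0,1\}^{\mathbb{N}}$ is represented by enumerations of finite words $w$ whose cylinders $w\{0,1\}^{\mathbb{N}}$ have union that set. Let $\lambda$ be the uniform measure on $\{0,1\}^{\mathbb{N}}$. A Martin-Löf test is a computable sequence $(U_i)_{i \in \mathbb{N}}$ of open subsets of $\{0,1\}^{\mathbb{N}}$ with $\lambda(U_i) \leq 2^{-i}$;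 it is universal if $\bigcap_i V_i \subseteq \bigcap_i U_i$ for every Martin-Löf test $(V_i)_{i \in \mathbb{N}}$. Let $\mathrm{MLR} \subseteq \{0,1\}^{\mathbb{N}}$ be the set of Martin-Löf random sequences, i.e. the complement of $\bigcap_i U_i$ for any universal test $(U_i)_{i\in\mathbb{N}}$, and let $d_{\mathrm{MLR}} : \mathrm{MLR} \to \{1\}$ be the unique map. For a universal test $\mathcal{U} = (U_i)_{i\in\mathbb{N}}$ let $\mathrm{LAY}_{\mathcal{U}} : \mathrm{MLR} \rightrightarrows \mathbb{N}$ be given by $n \in \mathrm{LAY}_{\mathcal{U}}(p)$ iff $p \notin U_n$. Let $\mathrm{LPO} : \mathbb{N}^{\mathbb{N}} \to \{0,1\}$ be given by $\mathrm{LPO}(0^{\mathbb{N}}) = 1$ and $\mathrm{LPO}(p) = 0$ for $p \neq 0^{\mathbb{N}}$. For any $f$ put $f^0 = \mathrm{id}_{\mathbb{N}^{\mathbb{N}}}$, $f^{n+1} = f^n \times f$ and $f^*(n,x) = f^n(x)$. Let $T$ be the shift on $\{0,1\}^{\mathbb{N}}$, let $\mathcal{O}^+$ be the space of nonempty open subsets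 of $\{0,1\}^{\mathbb{N}}$, and let $\mathrm{HittingTime}_{\mathcal{O}} : \mathrm{MLR} \times \mathcal{O}^+ \to \mathbb{N}$ be given by $\mathrm{HittingTime}_{\mathcal{O}}(p,U) = \min\{n \in \mathbb{N} \mid T^n(p) \in U\}$. Theorem. $\mathrm{HittingTime}_{\mathcal{O}} \equiv_W d_{\mathrm{MLR}} \times \mathrm{LPO}^*$. Moreover, for every universal Martin-Löf test $\mathcal{U} = (U_n)_{n \in \mathbb{N}}$, $d_{\mathrm{MLR}} \times \mathrm{LPO}^* <_W \mathrm{LAY}_{\mathcal{U}}$, and $\mathrm{HittingTime}_{\mathcal{O}}$ is not strongly layerwise computable with respect to $\mathcal{U}$, i.e. it is not the case that for every $n$ the restriction of $\mathrm{HittingTime}_{\mathcal{O}}$ to $(\{0,1\}^{\mathbb{N}} \setminus U_n) \times \mathcal{O}^+$ is computable. -/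

import Mathlib

open scoped ENNReal

namespace TTE

/-! ### Computability on Baire space -/

/-- Baire space. -/
abbrev Baire : Type := ℕ → ℕ

/-- Cantor space. -/
abbrev Cantor : Type := ℕ → Bool

/-- The prefix of length `n` of a sequence. -/
def initSeg {A : Type} (x : ℕ → A) (n : ℕ) : List A := (List.range n).map x

/-- Computable partial functions on Baire space: `F` is computable if there is a computable
word function `h`, monotone with respect to the prefix order, such that `F p` is the limit of
the words `h (p↾k)`; the domain of `F` consists of those `p` for which this limit is infinite. -/
def ComputableBaire (F : Baire →. Baire) : Prop :=
  ∃ h : List ℕ → List ℕ, Computable h ∧ (∀ u v, u <+: v → h u <+: h v) ∧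
    ∀ p q : Baire, q ∈ F p ↔ ∀ i, ∃ k, (h (initSeg p k))[i]? = some (q i)

/-- The even part of a sequence (first component of a pair). -/
def fstPart (p : Baire) : Baire := fun n => p (2 * n)

/-- The odd part of a sequence (second component of a pair). -/
def sndPart (p : Baire) : Baire := fun n => p (2 * n + 1)

/-- The standard pairing function on Baire space, interleaving two sequences. -/
def pairing (p q : Baire) : Baire := fun n => if n % 2 = 0 then p (n / 2) else q (n / 2)

theorem fstPart_pairing (p q : Baire) : fstPart (pairing p q) = p := by
  funext n
  simp [fstPart, pairing]

theorem sndPart_pairing (p q : Baire) : sndPart (pairing p q) = q := by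
  funext n
  have h1 : (2 * n + 1) % 2 = 1 := by omega
  have h2 : (2 * n + 1) / 2 = n := by omega
  simp [sndPart, pairing, h1, h2]

/-! ### Represented spaces -/

/-- A represented space: a set `X` with a partial surjection from Baire space onto `X`,
given by its graph (`IsName p x` means that `p` is a name of `x`). -/
class Represented (X : Type) where
  /-- `p` is a name of `x` -/
  IsName : Baire → X → Prop
  unique : ∀ p x y, IsName p x → IsName p y → x = y
  surj : ∀ x, ∃ p, IsName p x

/-- Baire space, represented by the identity. -/
instance : Represented Baire where
  IsName p x := p = x
  unique _ _ _ h1 h2 := h1.symm.trans h2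
  surj x := ⟨x, rfl⟩

/-- The natural numbers: `p` is a name of `p 0`. -/
instance : Represented ℕ where
  IsName p n := p 0 = n
  unique _ _ _ h1 h2 := h1.symm.trans h2
  surj n := ⟨fun _ => n, rfl⟩

/-- Cantor space, represented as the subspace of the sequences in Baire space with values
`0` and `1`. -/
instance : Represented Cantor where
  IsName p x := ∀ i, p i = (x i).toNat
  unique p x y h1 h2 := by
    funext i
    have h := (h1 i).symm.trans (h2 i)
    revert h
    cases x i <;> cases y i <;> simp
  surj x := ⟨fun i => (x i).toNat, fun _ => rfl⟩

/-- Subspaces. -/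
instance {X : Type} [Represented X] (S : Set X) : Represented S where
  IsName p x := Represented.IsName p (x : X)
  unique p _ _ h1 h2 := Subtype.ext (Represented.unique p _ _ h1 h2)
  surj x := Represented.surj (x : X)

/-- Products. -/
instance {X Y : Type} [Represented X] [Represented Y] : Represented (X × Y) where
  IsName p z := Represented.IsName (fstPart p) z.1 ∧ Represented.IsName (sndPart p) z.2
  unique p z w h1 h2 :=
    Prod.ext (Represented.unique _ _ _ h1.1 h2.1) (Represented.unique _ _ _ h1.2 h2.2)
  surj z := by
    obtain ⟨p, hp⟩ := Represented.surj z.1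
    obtain ⟨q, hq⟩ := Represented.surj z.2
    exact ⟨pairing p q, by rwa [fstPart_pairing], by rwa [sndPart_pairing]⟩

/-- Countable coproducts: a name of `⟨n, x⟩` is `n` followed by a name of `x`. -/
instance {X : ℕ → Type} [∀ n, Represented (X n)] : Represented (Σ n, X n) where
  IsName p z := p 0 = z.1 ∧ Represented.IsName (fun i => p (i + 1)) z.2
  unique := by
    rintro p ⟨n, x⟩ ⟨m, y⟩ ⟨h1, h2⟩ ⟨h3, h4⟩
    obtain rfl : n = m := h1.symm.trans h3
    exact congrArg _ (Represented.unique _ _ _ h2 h4)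
  surj := by
    rintro ⟨n, x⟩
    obtain ⟨p, hp⟩ := Represented.surj x
    exact ⟨fun i => Nat.casesOn i n p, rfl, hp⟩

/-- The open set enumerated by `p`: the union of the cylinders `w{0,1}^ℕ` over all words `w`
such that `p i = code(w) + 1` for some `i` (an entry `0` lists nothing). A point lies in it
iff one of its prefixes is listed. -/
def enumeratedOpen (p : Baire) : Set Cantor :=
  {x | ∃ i n, p i = Encodable.encode (initSeg x n) + 1}

theorem initSeg_eq_of_mem_cylinder {x y : Cantor} {n : ℕ} (h : y ∈ PiNat.cylinder x n) :
    initSeg y n = initSeg x n := by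
  apply List.map_congr_left
  intro i hi
  exact h i (List.mem_range.1 hi)

theorem isOpen_enumeratedOpen (p : Baire) : IsOpen (enumeratedOpen p) := by
  rw [isOpen_iff_forall_mem_open]
  rintro x ⟨i, n, h⟩
  refine ⟨PiNat.cylinder x n, ?_, PiNat.isOpen_cylinder _ x n, PiNat.self_mem_cylinder x n⟩
  intro y hy
  exact ⟨i, n, by rw [initSeg_eq_of_mem_cylinder hy]; exact h⟩

theorem exists_enumeratedOpen {U : Set Cantor} (hU : IsOpen U) :
    ∃ p, enumeratedOpen p = U := by
  classical
  refine ⟨fun i => if ∃ x n, Encodable.encode (initSeg x n) = i ∧ PiNat.cylinder x n ⊆ U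
    then i + 1 else 0, ?_⟩
  ext y
  constructor
  · rintro ⟨i, n, h⟩
    by_cases hc : ∃ x n, Encodable.encode (initSeg x n) = i ∧ PiNat.cylinder x n ⊆ U
    · simp only [if_pos hc] at h
      obtain ⟨x, m, h1, h2⟩ := hc
      have h3 : initSeg x m = initSeg y n := Encodable.encode_injective (h1.trans (by omega))
      have hmn : m = n := by simpa [initSeg] using congrArg List.length h3
      subst hmn
      apply h2
      intro j hj
      have := List.map_inj_left.1 h3 j (List.mem_range.2 hj)
      exact this.symm
    · simp only [if_neg hc] at h
      omega
  · intro hy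
    obtain ⟨V, ⟨x, n, rfl⟩, h1, h2⟩ :=
      (PiNat.isTopologicalBasis_cylinders (fun _ : ℕ => Bool)).exists_subset_of_mem_open hy hU
    refine ⟨Encodable.encode (initSeg x n), n, ?_⟩
    rw [initSeg_eq_of_mem_cylinder h1]
    exact if_pos ⟨x, n, rfl, h2⟩

/-- The hyperspace of open subsets of Cantor space. -/
instance : Represented (TopologicalSpace.Opens Cantor) where
  IsName p U := enumeratedOpen p = U
  unique _ _ _ h1 h2 := TopologicalSpace.Opens.ext (h1.symm.trans h2)
  surj U := exists_enumeratedOpen U.isOpen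

/-! ### Multivalued functions and Weihrauch reducibility

A multivalued function `f : X ⇉ Y` is a map `X → Set Y`. -/

section

variable {X Y X' Y' : Type} [Represented X] [Represented Y] [Represented X'] [Represented Y']

/-- `F` is a realizer of `f`. -/
def Realizes (F : Baire →. Baire) (f : X → Set Y) : Prop :=
  ∀ p x, Represented.IsName p x → ∃ q ∈ F p, ∃ y ∈ f x, Represented.IsName q y

/-- A multivalued function is computable if it has a computable realizer. -/
def IsComputable (f : X → Set Y) : Prop :=
  ∃ F, ComputableBaire F ∧ Realizes F f

/-- Weihrauch reducibility. -/
def WReducible (f : X → Set Y) (g : X' → Set Y') : Prop :=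
  ∃ K H : Baire →. Baire, ComputableBaire K ∧ ComputableBaire H ∧
    ∀ G : Baire →. Baire, Realizes G g →
      Realizes (fun p => (H p).bind fun r => (G r).bind fun q => K (pairing p q)) f

/-- Weihrauch equivalence. -/
def WEquiv (f : X → Set Y) (g : X' → Set Y') : Prop :=
  WReducible f g ∧ WReducible g f

/-- Strict Weihrauch reducibility. -/
def WStrict (f : X → Set Y) (g : X' → Set Y') : Prop :=
  WReducible f g ∧ ¬ WReducible g f

end

/-- The product of multivalued functions. -/
def mvProd {X Y X' Y' : Type} (f : X → Set Y) (g : X' → Set Y') : X × X' → Set (Y × Y') :=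
  fun z => f z.1 ×ˢ g z.2

/-- The carriers of the finite powers: `X^0` is Baire space and `X^(n+1) = X^n × X`. -/
def PowSpace (X : Type) : ℕ → Type
  | 0 => Baire
  | n + 1 => PowSpace X n × X

/-- The representations of the finite powers. -/
@[reducible] def powRepresented (X : Type) [Represented X] : (n : ℕ) → Represented (PowSpace X n)
  | 0 => inferInstanceAs (Represented Baire)
  | n + 1 =>
    letI := powRepresented X n
    inferInstanceAs (Represented (PowSpace X n × X))

instance (X : Type) [Represented X] (n : ℕ) : Represented (PowSpace X n) := powRepresented X n

/-- The finite powers of a multivalued function: `f^0` is the identity of Baire space and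
`f^(n+1) = f^n × f`. -/
def mvPow {X Y : Type} (f : X → Set Y) : (n : ℕ) → PowSpace X n → Set (PowSpace Y n)
  | 0 => fun x => {x}
  | n + 1 => mvProd (mvPow f n) f

/-- The Kleene star `f*(n, x) = f^n(x)`. -/
def mvStar {X Y : Type} (f : X → Set Y) : (Σ n, PowSpace X n) → Set (Σ n, PowSpace Y n) :=
  fun z => Sigma.mk z.1 '' mvPow f z.1 z.2

/-- `LPO(0^ℕ) = 1` and `LPO(p) = 0` for all other `p`. -/
def LPO : Baire → Set ({0, 1} : Set ℕ) :=
  fun p => {y | (p = (fun _ => 0) ∧ (y : ℕ) = 1) ∨ (p ≠ (fun _ => 0) ∧ (y : ℕ) = 0)}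

/-- The unique map `d_A : A → {1}`. -/
def dMap {X : Type} (A : Set X) : A → Set ({1} : Set ℕ) := fun _ => {⟨1, rfl⟩}

/-! ### Randomness -/

/-- The uniform (Lebesgue, fair coin) measure on Cantor space. -/
noncomputable def cantorMeasure : MeasureTheory.Measure Cantor :=
  MeasureTheory.Measure.infinitePi fun _ : ℕ => (PMF.uniformOfFintype Bool).toMeasure

/-- Martin-Löf tests: computable sequences of open sets with `λ(U_i) ≤ 2^(-i)`. -/
def IsMLTest (U : ℕ → TopologicalSpace.Opens Cantor) : Prop :=
  IsComputable (fun i => ({U i} : Set (TopologicalSpace.Opens Cantor))) ∧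
    ∀ i, cantorMeasure (U i : Set Cantor) ≤ (2 : ℝ≥0∞)⁻¹ ^ i

/-- Universal Martin-Löf tests. -/
def IsUniversalMLTest (U : ℕ → TopologicalSpace.Opens Cantor) : Prop :=
  IsMLTest U ∧ ∀ V, IsMLTest V → (⋂ i, (V i : Set Cantor)) ⊆ ⋂ i, (U i : Set Cantor)

/-- The Martin-Löf random sequences: those that pass every Martin-Löf test. -/
def MLR : Set Cantor := {x | ∀ V, IsMLTest V → x ∉ ⋂ i, (V i : Set Cantor)}

/-- This is the complement of the null set of any universal test. -/
theorem MLR_eq {U : ℕ → TopologicalSpace.Opens Cantor} (hU : IsUniversalMLTest U) :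
    MLR = (⋂ i, (U i : Set Cantor))ᶜ := by
  ext x
  exact ⟨fun h => h U hU.1, fun h V hV hx => h (hU.2 V hV hx)⟩

/-- `n ∈ LAY_U(p)` iff `p ∉ U_n`. -/
def LAY (U : ℕ → TopologicalSpace.Opens Cantor) : MLR → Set ℕ :=
  fun p => {n | (p : Cantor) ∉ U n}

/-- `f` on `MLR × X` is strongly layerwise computable with respect to `U` if for every `n`
its restriction to `U_nᶜ × X` is computable. -/
def StronglyLayerwiseComputable {X Y : Type} [Represented X] [Represented Y]
    (U : ℕ → TopologicalSpace.Opens Cantor) (f : MLR × X → Set Y) : Prop :=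
  ∀ n, IsComputable (fun z : {z : MLR × X | (z.1 : Cantor) ∉ U n} => f (z : MLR × X))

/-! ### Hitting time -/

/-- The shift operator. -/
def shift (x : Cantor) : Cantor := fun n => x (n + 1)

/-- The nonempty open subsets of Cantor space. -/
def NonemptyOpens : Set (TopologicalSpace.Opens Cantor) := {U | (U : Set Cantor).Nonempty}

/-- The hitting time of the shift orbit of a random sequence into a nonempty open set. -/
def HittingTime : MLR × NonemptyOpens → Set ℕ :=
  fun z => {n | IsLeast {m : ℕ | shift^[m] (z.1 : Cantor) ∈
    (z.2 : TopologicalSpace.Opens Cantor)} n}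

end TTE

/-! To answer n instances of `LPO` it suffices to know a stage at which every nonzero instance has
shown a nonzero digit. The number of nonzero instances yields such a stage, since one can wait until
that many have been seen. The positive reductions rest on this, the negative results on continuity
of computable functionals.

Hitting times reduce to `LPO*` (`hittingTime_le`): the orbit of a random x meets every nonempty open
U, because avoiding a word w in successive independent blocks has exponentially small measure. Once
some hit is verified, the hitting time is bounded, and each membership of a shift in U below the
bound is one question to `LPO`.

Conversely (`le_hittingTime`), a random x is not eventually periodic, so its shifts are pairwise
distinct. Enumerate longer and longer prefixes of T^(n-c')(x), where c' counts the nonzero instances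
seen so far. As c' grows, the target only moves to earlier times, so the hitting time of the
resulting open set is n-c with c the final count.

For the reduction to layers (`le_LAY`), a sequence y is built that copies x, but writes zeros as
long as some j is a false bound: an instance is seen to be nonzero that was not seen within the
first j digits, and y is not yet known to lie in U_j. If y were not random, it would lie in every
U_j, so copying would eventually resume for good and y would be random after all. If y is outside
U_j, then j must be a correct bound, since otherwise y would end in zeros, be non-random and lie in
U_j.

There is no reduction back (`not_LAY_le`): being nonzero is an open condition, so near a random
point where the number of nonzero instances is maximal, the answers are constant and the computed
layer k is locally constant. But U_k is dense in the random sequences. Finally, a hitting time fails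
to be continuous even for one fixed x, because a late entry of the enumeration can lower it to 0
(`not_stronglyLayerwiseComputable_hittingTime`). -/

namespace TTE

/-! ### Prefixes -/

section Prefixes

variable {A : Type}

@[simp] theorem length_initSeg (x : ℕ → A) (n : ℕ) : (initSeg x n).length = n := by
  simp [initSeg]

theorem getD_initSeg (x : ℕ → A) {n i : ℕ} (d : A) (h : i < n) : (initSeg x n).getD i d = x i := by
  simp [initSeg, h]

theorem getD_initSeg_of_le (x : ℕ → A) {n i : ℕ} (d : A) (h : n ≤ i) :
    (initSeg x n).getD i d = d := by
  simp [initSeg, h]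

theorem take_initSeg (x : ℕ → A) {k n : ℕ} (h : k ≤ n) :
    (initSeg x n).take k = initSeg x k := by
  rw [initSeg, ← List.map_take, List.take_range, min_eq_left h, initSeg]

theorem initSeg_isPrefix (x : ℕ → A) {k n : ℕ} (h : k ≤ n) : initSeg x k <+: initSeg x n := by
  rw [← take_initSeg x h]
  exact List.take_prefix _ _

theorem initSeg_eq_iff {x y : ℕ → A} {n : ℕ} :
    initSeg x n = initSeg y n ↔ ∀ i < n, x i = y i := by
  simp [initSeg, List.map_inj_left]

theorem initSeg_zero (x : ℕ → A) : initSeg x 0 = [] := rfl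

theorem initSeg_succ (x : ℕ → A) (n : ℕ) :
    initSeg x (n + 1) = x 0 :: initSeg (fun i => x (i + 1)) n := by
  simp [initSeg, List.range_succ_eq_map, Function.comp_def]

theorem initSeg_concat (x : ℕ → A) (n : ℕ) : initSeg x (n + 1) = initSeg x n ++ [x n] := by
  simp [initSeg, List.range_succ]

end Prefixes

/-! ### Primitive recursive predicates -/

theorem primrecPred_exists_lt {α : Type} [Primcodable α] {b : α → ℕ} {Q : ℕ → α → Prop}
    (hb : Primrec b) (hQ : PrimrecPred fun z : ℕ × α => Q z.1 z.2) :
    PrimrecPred fun a => ∃ x < b a, Q x a :=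
  ((PrimrecRel.exists_mem_list (R := Q) hQ).comp (Primrec.list_range.comp hb) Primrec.id).of_eq
    fun a => by simp

theorem primrecPred_forall_lt {α : Type} [Primcodable α] {b : α → ℕ} {Q : ℕ → α → Prop}
    (hb : Primrec b) (hQ : PrimrecPred fun z : ℕ × α => Q z.1 z.2) :
    PrimrecPred fun a => ∀ x < b a, Q x a :=
  ((PrimrecRel.forall_mem_list (R := Q) hQ).comp (Primrec.list_range.comp hb) Primrec.id).of_eq
    fun a => by simp

/-! ### Functionals computed in stages -/

open Classical in
/-- The partial functional that waits for the first prefix of the input satisfying `P`, and then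
produces each digit `i` of the output from that prefix and the prefix of length `2 * i + 2`. -/
noncomputable def staged (P : List ℕ → Prop) (φ : List ℕ → List ℕ → ℕ → ℕ) : Baire →. Baire :=
  fun p => ⟨∃ k, P (initSeg p k),
    fun h i => φ (initSeg p (Nat.find h)) (initSeg p (2 * i + 2)) i⟩

theorem mem_staged {P : List ℕ → Prop} {φ : List ℕ → List ℕ → ℕ → ℕ} {p q : Baire} :
    q ∈ staged P φ p ↔ ∃ k, (P (initSeg p k) ∧ ∀ j < k, ¬ P (initSeg p j)) ∧
      ∀ i, q i = φ (initSeg p k) (initSeg p (2 * i + 2)) i := by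
  classical
  constructor
  · rintro ⟨h, rfl⟩
    exact ⟨Nat.find h, ⟨Nat.find_spec h, fun j hj => Nat.find_min h hj⟩, fun i => rfl⟩
  · rintro ⟨k, hk, hq⟩
    have h : ∃ k, P (initSeg p k) := ⟨k, hk.1⟩
    refine ⟨h, ?_⟩
    funext i
    rw [hq]
    simp only [staged]
    rw [(Nat.find_eq_iff h).2 hk]

theorem exists_mem_staged {P : List ℕ → Prop} (φ : List ℕ → List ℕ → ℕ → ℕ) {p : Baire}
    (h : ∃ k, P (initSeg p k)) : ∃ q, q ∈ staged P φ p :=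
  ⟨_, h, rfl⟩

/-- The word function outputs nothing until a prefix satisfying `P` appears, then as many digits as
the input read so far determines. The first such prefix never changes, which gives monotonicity. -/
theorem computableBaire_staged {P : List ℕ → Prop} {φ : List ℕ → List ℕ → ℕ → ℕ}
    (hP : PrimrecPred P) (hφ : Primrec fun z : List ℕ × List ℕ × ℕ => φ z.1 z.2.1 z.2.2) :
    ComputableBaire (staged P φ) := by
  classical
  -- If no prefix satisfies `P`, `findIdx` returns `u.length + 1`; hence `idx u ≤ u.length`
  -- expresses success.
  let idx : List ℕ → ℕ := fun u =>
    (List.range (u.length + 1)).findIdx fun k => decide (P (u.take k))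
  have hidx : ∀ u k, k ≤ u.length →
      (idx u = k ↔ P (u.take k) ∧ ∀ j < k, ¬ P (u.take j)) := by
    intro u k hk
    rw [List.findIdx_eq (by simpa using Nat.lt_succ_of_le hk)]
    simp
  let h : List ℕ → List ℕ := fun u => if idx u ≤ u.length then
    -- For `i < u.length / 2` the prefix of length `2 * i + 2` lies inside `u`, so the digits
    -- written are final.
    (List.range (u.length / 2)).map fun i => φ (u.take (idx u)) (u.take (2 * i + 2)) i else []
  have pidx : Primrec idx := by
    refine Primrec.list_findIdx (Primrec.list_range.comp (Primrec.succ.comp Primrec.list_length)) ?_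
    exact PrimrecPred.decide (hP.comp (Primrec.list_take.comp Primrec.snd Primrec.fst))
  have ph : Primrec h := by
    refine Primrec.ite (Primrec.nat_le.comp pidx Primrec.list_length) ?_ (Primrec.const [])
    refine Primrec.list_map (Primrec.list_range.comp
      (Primrec.nat_div.comp Primrec.list_length (Primrec.const 2))) ?_
    refine hφ.comp (Primrec.pair (Primrec.list_take.comp (pidx.comp Primrec.fst) Primrec.fst)
      (Primrec.pair (Primrec.list_take.comp ?_ Primrec.fst) Primrec.snd))
    exact Primrec.succ.comp (Primrec.succ.comp (Primrec.nat_double.comp Primrec.snd))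
  have htake : ∀ u v : List ℕ, u <+: v → ∀ k ≤ u.length, v.take k = u.take k := by
    rintro u v ⟨w, rfl⟩ k hk
    exact List.take_append_of_le_length hk
  refine ⟨h, ph.to_comp, ?_, ?_⟩
  · intro u v huv
    by_cases hu : idx u ≤ u.length
    · have e : idx v = idx u := by
        rw [hidx v _ (hu.trans huv.length_le), htake u v huv _ hu]
        have := (hidx u _ hu).1 rfl
        refine ⟨this.1, fun j hj => ?_⟩
        rw [htake u v huv _ (hj.le.trans hu)]
        exact this.2 j hj
      have hv : idx v ≤ v.length := e ▸ hu.trans huv.length_le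
      simp only [h, if_pos hu, if_pos hv, e, htake u v huv _ hu]
      have hl := huv.length_le
      have : List.map (fun i => φ (u.take (idx u)) (u.take (2 * i + 2)) i)
            (List.range (u.length / 2)) =
          List.map (fun i => φ (u.take (idx u)) (v.take (2 * i + 2)) i)
            (List.range (u.length / 2)) := by
        refine List.map_congr_left fun i hi => ?_
        rw [htake u v huv]
        have := List.mem_range.1 hi
        omega
      rw [this, ← min_eq_left (Nat.div_le_div_right (c := 2) hl), ← List.take_range, List.map_take]
      exact List.take_prefix _ _
    · simp only [h, if_neg hu]
      exact List.nil_prefix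
  · intro p q
    rw [mem_staged]
    have key : ∀ K i a, (h (initSeg p K))[i]? = some a ↔ i < K / 2 ∧ ∃ k ≤ K,
        (P (initSeg p k) ∧ ∀ j < k, ¬ P (initSeg p j)) ∧
          φ (initSeg p k) (initSeg p (2 * i + 2)) i = a := by
      intro K i a
      have hk : ∀ k ≤ K, (idx (initSeg p K) = k ↔
          P (initSeg p k) ∧ ∀ j < k, ¬ P (initSeg p j)) := by
        intro k hkK
        rw [hidx _ k (by simpa using hkK), take_initSeg p hkK]
        refine and_congr_right fun _ => forall₂_congr fun j hj => ?_
        rw [take_initSeg p (hj.le.trans hkK)]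
      by_cases hu : idx (initSeg p K) ≤ K
      · simp only [h, length_initSeg, if_pos hu, List.getElem?_map, Option.map_eq_some_iff]
        constructor
        · rintro ⟨i', hi', rfl⟩
          obtain ⟨hi, rfl⟩ : i < K / 2 ∧ i = i' := by
            simpa [List.getElem?_eq_some_iff] using hi'
          refine ⟨hi, _, hu, (hk _ hu).1 rfl, ?_⟩
          rw [take_initSeg p hu, take_initSeg p (by omega)]
        · rintro ⟨hi, k, hkK, hk', rfl⟩
          refine ⟨i, by simp [hi], ?_⟩
          rw [(hk k hkK).2 hk', take_initSeg p hkK, take_initSeg p (by omega)]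
      · simp only [h, length_initSeg, if_neg hu]
        simp only [List.getElem?_nil, reduceCtorEq, false_iff]
        rintro ⟨-, k, hkK, hk', -⟩
        exact hu (((hk k hkK).2 hk').le.trans hkK)
    simp only [key]
    constructor
    · rintro ⟨k, hk, hq⟩ i
      exact ⟨max k (2 * i + 2), by omega, k, le_max_left _ _, hk, (hq i).symm⟩
    · intro H
      obtain ⟨_, _, k, _, hk, _⟩ := H 0
      refine ⟨k, hk, fun i => ?_⟩
      obtain ⟨_, _, k', _, hk', e⟩ := H i
      have : k' = k := by
        rcases lt_trichotomy k k' with h1 | h1 | h1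
        · exact absurd hk.1 (hk'.2 _ h1)
        · exact h1.symm
        · exact absurd hk'.1 (hk.2 _ h1)
      rw [← e, this]

/-- Functionals whose `i`-th output digit depends on the first `2 * i + 2` input digits. -/
theorem exists_computableBaire_synchronous {φ : List ℕ → ℕ → ℕ} (hφ : Primrec₂ φ) :
    ∃ F, ComputableBaire F ∧ ∀ p, (fun i => φ (initSeg p (2 * i + 2)) i) ∈ F p := by
  refine ⟨staged (fun _ => True) fun _ u i => φ u i,
    computableBaire_staged ((Primrec.eq.comp (Primrec.const 0) (Primrec.const 0)).of_eq (by simp))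
      (hφ.comp (Primrec.fst.comp Primrec.snd) (Primrec.snd.comp Primrec.snd)), fun p => ?_⟩
  exact mem_staged.2 ⟨0, ⟨trivial, by simp⟩, fun i => rfl⟩

/-- Computable functionals are continuous. -/
theorem ComputableBaire.eventually_eq {F : Baire →. Baire} (hF : ComputableBaire F)
    {X : Type} {l : Filter X} {f g : X → Baire} {f₀ g₀ : Baire}
    (hf : ∀ j, ∀ᶠ x in l, f x j = f₀ j) (hg : ∀ᶠ x in l, g x ∈ F (f x)) (h₀ : g₀ ∈ F f₀) (i : ℕ) :
    ∀ᶠ x in l, g x i = g₀ i := by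
  obtain ⟨h, -, hm, hF⟩ := hF
  obtain ⟨k, hk⟩ := (hF _ _).1 h₀ i
  have h1 : ∀ᶠ x in l, ∀ j ∈ Finset.range k, f x j = f₀ j :=
    (Finset.eventually_all _).2 fun j _ => hf j
  filter_upwards [h1, hg] with x hx hgx
  obtain ⟨k', hk'⟩ := (hF _ _).1 hgx i
  have e : initSeg (f x) k = initSeg f₀ k :=
    initSeg_eq_iff.2 fun j hj => hx j (Finset.mem_range.2 hj)
  rw [← e] at hk
  have up : ∀ k a, (h (initSeg (f x) k))[i]? = some a → ∀ m, k ≤ m →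
      (h (initSeg (f x) m))[i]? = some a := by
    intro k a hka m hm'
    obtain ⟨t, ht⟩ := hm _ _ (initSeg_isPrefix (f x) hm')
    obtain ⟨hl, hl'⟩ := List.getElem?_eq_some_iff.1 hka
    rw [← ht, List.getElem?_append_left hl, hka]
  have a1 := up _ _ hk _ (le_max_left k k')
  have a2 := up _ _ hk' _ (le_max_right k k')
  rw [a1] at a2
  exact (Option.some_injective _ a2).symm


/-! ### Effectively open sequences -/

theorem isOpen_setOf_exists_initSeg (R : List Bool → ℕ → Prop) :
    IsOpen {x : Cantor | ∃ n s, R (initSeg x n) s} := by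
  rw [isOpen_iff_forall_mem_open]
  rintro x ⟨n, s, h⟩
  refine ⟨PiNat.cylinder x n, ?_, PiNat.isOpen_cylinder _ x n, PiNat.self_mem_cylinder x n⟩
  intro y hy
  exact ⟨n, s, by rwa [initSeg_eq_of_mem_cylinder hy]⟩

/-- The output index m codes a pair of a word and a stage; the word is listed at m if `R` accepts
the pair, and otherwise the entry is 0, which lists nothing. -/
theorem isComputable_of_primrec {U : ℕ → TopologicalSpace.Opens Cantor}
    {R : ℕ → List Bool → ℕ → Prop}
    (hR : PrimrecPred fun z : ℕ × List Bool × ℕ => R z.1 z.2.1 z.2.2)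
    (hU : ∀ i x, x ∈ U i ↔ ∃ n s, R i (initSeg x n) s) :
    IsComputable (fun i => ({U i} : Set (TopologicalSpace.Opens Cantor))) := by
  classical
  let word : ℕ → List Bool := fun m => (Encodable.decode (α := List Bool) m.unpair.1).getD []
  let φ : List ℕ → ℕ → ℕ := fun u m =>
    if R (u.getD 0 0) (word m) m.unpair.2 then Encodable.encode (word m) + 1 else 0
  have hword : Primrec word := Primrec.option_getD.comp
    (Primrec.decode.comp (Primrec.fst.comp Primrec.unpair)) (Primrec.const [])
  have hφ : Primrec₂ φ := by
    refine Primrec.ite (hR.comp (Primrec.pair ((Primrec.list_getD 0).comp Primrec.fst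
      (Primrec.const 0)) (Primrec.pair (hword.comp Primrec.snd)
      (Primrec.snd.comp (Primrec.unpair.comp Primrec.snd))))) ?_ (Primrec.const 0)
    exact Primrec.succ.comp (Primrec.encode.comp (hword.comp Primrec.snd))
  obtain ⟨F, hF, hFp⟩ := exists_computableBaire_synchronous hφ
  refine ⟨F, hF, fun p i hp => ⟨_, hFp p, U i, rfl, ?_⟩⟩
  change enumeratedOpen _ = _
  ext x
  rw [SetLike.mem_coe, hU]
  have h0 : ∀ m, (initSeg p (2 * m + 2)).getD 0 0 = i := fun m => by
    rw [getD_initSeg p 0 (by omega)]; exact hp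
  constructor
  · rintro ⟨m, n, h⟩
    simp only [φ, h0] at h
    split_ifs at h with hr
    refine ⟨n, m.unpair.2, ?_⟩
    have : word m = initSeg x n := Encodable.encode_injective (by omega)
    rwa [← this]
  · rintro ⟨n, s, h⟩
    refine ⟨Nat.pair (Encodable.encode (initSeg x n)) s, n, ?_⟩
    have : word (Nat.pair (Encodable.encode (initSeg x n)) s) = initSeg x n := by simp [word]
    simp only [φ, h0, this, Nat.unpair_pair, if_pos h]

/-- The constant sequence i is a name of i. The stage s codes a step bound, an input length and an
output position; running the word function only up to the step bound makes the relation primitive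
recursive. -/
theorem exists_primrec_of_isComputable {U : ℕ → TopologicalSpace.Opens Cantor}
    (hU : IsComputable (fun i => ({U i} : Set (TopologicalSpace.Opens Cantor)))) :
    ∃ R : ℕ → List Bool → ℕ → Prop,
      (PrimrecPred fun z : ℕ × List Bool × ℕ => R z.1 z.2.1 z.2.2) ∧
      ∀ i x, x ∈ U i ↔ ∃ n s, R i (initSeg x n) s := by
  obtain ⟨F, ⟨h, hc, hm, hF⟩, hr⟩ := hU
  obtain ⟨c, hc⟩ := Nat.Partrec.Code.exists_code.1 hc
  let R : ℕ → List Bool → ℕ → Prop := fun i w s =>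
    ((Nat.Partrec.Code.evaln s.unpair.1 c
      (Encodable.encode ((List.range s.unpair.2.unpair.1).map fun _ => i))).bind fun a =>
      (Encodable.decode (α := List ℕ) a).bind fun l => l[s.unpair.2.unpair.2]?) =
        some (Encodable.encode w + 1)
  refine ⟨R, ?_, fun i x => ?_⟩
  · have hs : Primrec fun z : ℕ × List Bool × ℕ => z.2.2 := Primrec.snd.comp Primrec.snd
    have h2 := Primrec.snd.comp (Primrec.unpair.comp hs)
    refine Primrec.eq.comp (Primrec.option_bind ?_ (Primrec.option_bind ?_ ?_)) ?_
    · refine Nat.Partrec.Code.primrec_evaln.comp (Primrec.pair (Primrec.pair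
        (Primrec.fst.comp (Primrec.unpair.comp hs)) (Primrec.const c)) (Primrec.encode.comp ?_))
      exact Primrec.list_map (Primrec.list_range.comp (Primrec.fst.comp (Primrec.unpair.comp h2)))
        (Primrec.fst.comp Primrec.fst)
    · exact Primrec.decode.comp Primrec.snd
    · exact Primrec.list_getElem?.comp Primrec.snd
        ((Primrec.snd.comp (Primrec.unpair.comp h2)).comp (Primrec.fst.comp Primrec.fst))
    · exact Primrec.option_some.comp (Primrec.succ.comp (Primrec.encode.comp
        (Primrec.fst.comp Primrec.snd)))
  · obtain ⟨q, hq, V, rfl, hV⟩ := hr (fun _ => i) i rfl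
    have hV : enumeratedOpen q = U i := hV
    have hq := (hF _ _).1 hq
    rw [← SetLike.mem_coe, ← hV]
    have hrange : ∀ k, (List.range k).map (fun _ => i) = initSeg (fun _ => i) k := fun _ => rfl
    have hev : ∀ (l : List ℕ) a, (∃ t, Nat.Partrec.Code.evaln t c (Encodable.encode l) = some a) ↔
        Encodable.encode (h l) = a := by
      intro l a
      have e : (∃ t, Nat.Partrec.Code.evaln t c (Encodable.encode l) = some a) ↔
          a ∈ Nat.Partrec.Code.eval c (Encodable.encode l) :=
        Nat.Partrec.Code.evaln_complete.symm
      rw [e, hc]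
      simp [eq_comm]
    have up : ∀ k j a : ℕ, (h (initSeg (fun _ => i) k))[j]? = some a → ∀ m, k ≤ m →
        (h (initSeg (fun _ => i) m))[j]? = some a := by
      intro k j a hka m hm'
      obtain ⟨t, ht⟩ := hm _ _ (initSeg_isPrefix (fun _ => i) hm')
      obtain ⟨hl, hl'⟩ := List.getElem?_eq_some_iff.1 hka
      rw [← ht, List.getElem?_append_left hl, hka]
    constructor
    · rintro ⟨j, n, hj⟩
      obtain ⟨k, hk⟩ := hq j
      obtain ⟨t, ht⟩ := (hev (initSeg (fun _ => i) k) _).2 rfl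
      refine ⟨n, Nat.pair t (Nat.pair k j), ?_⟩
      simp only [R, Nat.unpair_pair, hrange, ht, Option.bind_some, Encodable.encodek, hk, hj]
    · rintro ⟨n, s, hs⟩
      simp only [R, hrange, Option.bind_eq_some_iff] at hs
      obtain ⟨a, ha, l, hl, hls⟩ := hs
      have ha := (hev _ _).1 ⟨_, ha⟩
      rw [← ha, Encodable.encodek] at hl
      obtain rfl := Option.some_injective _ hl
      obtain ⟨k, hk⟩ := hq s.unpair.2.unpair.2
      refine ⟨s.unpair.2.unpair.2, n, ?_⟩
      have a1 := up _ _ _ hk _ (le_max_left k s.unpair.2.unpair.1)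
      have a2 := up _ _ _ hls _ (le_max_right k s.unpair.2.unpair.1)
      rw [a1] at a2
      exact Option.some_injective _ a2

/-! ### The uniform measure -/

instance : MeasureTheory.IsProbabilityMeasure cantorMeasure := by
  unfold cantorMeasure; infer_instance

theorem measurable_shift : Measurable shift :=
  measurable_pi_lambda _ fun n => measurable_pi_apply (n + 1)

theorem measurableSet_head (b : Bool) : MeasurableSet {x : Cantor | x 0 = b} :=
  measurableSet_eq_fun (measurable_pi_apply 0) measurable_const

/-- Conditioning on the first bit and then shifting gives a measure that agrees with the product
measure on boxes, hence equals it. -/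
theorem cantorMeasure_head_inter_shift (b : Bool) {A : Set Cantor} (hA : MeasurableSet A) :
    cantorMeasure ({x | x 0 = b} ∩ shift ⁻¹' A) = 2⁻¹ * cantorMeasure A := by
  let ν := (2 : ℝ≥0∞) • ((cantorMeasure.restrict {x | x 0 = b}).map shift)
  have hν : ∀ A, MeasurableSet A → ν A = 2 * cantorMeasure ({x | x 0 = b} ∩ shift ⁻¹' A) := by
    intro A hA
    simp only [ν, MeasureTheory.Measure.smul_apply, smul_eq_mul]
    rw [MeasureTheory.Measure.map_apply measurable_shift hA,
      MeasureTheory.Measure.restrict_apply (measurable_shift hA), Set.inter_comm]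
  have h1 : ν = cantorMeasure := by
    refine MeasureTheory.Measure.eq_infinitePi _ fun s t ht => ?_
    rw [hν _ (MeasurableSet.pi s.countable_toSet fun i _ => ht i)]
    let t' : ℕ → Set Bool := fun n => Nat.casesOn n {b} t
    have hs : {x : Cantor | x 0 = b} ∩ shift ⁻¹' (Set.pi s t) =
        Set.pi ((insert 0 (s.map ⟨Nat.succ, Nat.succ_injective⟩) : Finset ℕ) : Set ℕ) t' := by
      ext x
      simp [Set.mem_pi, t', shift]
    rw [hs, cantorMeasure, MeasureTheory.Measure.infinitePi_pi _ (fun i _ => by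
      cases i with
      | zero => exact MeasurableSet.singleton b
      | succ n => exact ht n), Finset.prod_insert (by simp), Finset.prod_map]
    have hb : (PMF.uniformOfFintype Bool).toMeasure {b} = 2⁻¹ := by
      rw [PMF.toMeasure_apply_singleton _ _ (MeasurableSet.singleton b),
        PMF.uniformOfFintype_apply, Fintype.card_bool, Nat.cast_ofNat]
    simp only [t', Function.Embedding.coeFn_mk]
    change 2 * ((PMF.uniformOfFintype Bool).toMeasure {b} * _) = _
    rw [hb, ← mul_assoc, ENNReal.mul_inv_cancel (by simp) (by simp), one_mul]
  have h2 := hν A hA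
  rw [h1] at h2
  rw [h2, ← mul_assoc, ENNReal.inv_mul_cancel (by simp) (by simp), one_mul]

theorem cantorMeasure_shift_preimage {A : Set Cantor} (hA : MeasurableSet A) :
    cantorMeasure (shift ⁻¹' A) = cantorMeasure A := by
  have h : shift ⁻¹' A = ({x | x 0 = true} ∩ shift ⁻¹' A) ∪ ({x | x 0 = false} ∩ shift ⁻¹' A) := by
    ext x
    cases h : x 0 <;> simp [h]
  have hd : Disjoint ({x : Cantor | x 0 = true} ∩ shift ⁻¹' A)
      ({x | x 0 = false} ∩ shift ⁻¹' A) := by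
    rw [Set.disjoint_left]
    rintro x ⟨h1, -⟩ ⟨h2, -⟩
    simp_all
  rw [h, MeasureTheory.measure_union hd ((measurableSet_head false).inter (measurable_shift hA)),
    cantorMeasure_head_inter_shift _ hA, cantorMeasure_head_inter_shift _ hA, ← add_mul,
    ENNReal.inv_two_add_inv_two, one_mul]

/-- Prepending a bit. -/
def cons (b : Bool) (x : Cantor) : Cantor := fun n => Nat.casesOn n b x

theorem cons_shift (x : Cantor) : cons (x 0) (shift x) = x := by
  funext n; cases n <;> rfl

theorem measurable_cons (b : Bool) : Measurable (cons b) := by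
  refine measurable_pi_lambda _ fun n => ?_
  cases n with
  | zero => exact measurable_const
  | succ n => exact measurable_pi_apply n

theorem cantorMeasure_cons_preimage_le (b : Bool) {A : Set Cantor} (hA : MeasurableSet A) :
    cantorMeasure (cons b ⁻¹' A) ≤ 2 * cantorMeasure A := by
  have h := cantorMeasure_head_inter_shift b (measurable_cons b hA)
  have h2 : {x : Cantor | x 0 = b} ∩ shift ⁻¹' (cons b ⁻¹' A) ⊆ A := by
    rintro x ⟨rfl, hx⟩
    rw [Set.mem_preimage, Set.mem_preimage, cons_shift] at hx
    exact hx
  calc cantorMeasure (cons b ⁻¹' A) = 2 * (2⁻¹ * cantorMeasure (cons b ⁻¹' A)) := by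
        rw [← mul_assoc, ENNReal.mul_inv_cancel (by simp) (by simp), one_mul]
    _ ≤ 2 * cantorMeasure A := by
        rw [← h]; gcongr

theorem shift_iterate_apply (k n : ℕ) (x : Cantor) : shift^[k] x n = x (k + n) := by
  induction k generalizing x with
  | zero => simp
  | succ k ih => rw [Function.iterate_succ_apply, ih, shift]; congr 1; omega

theorem cantorMeasure_shift_iterate_preimage (k : ℕ) {A : Set Cantor} (hA : MeasurableSet A) :
    cantorMeasure (shift^[k] ⁻¹' A) = cantorMeasure A := by
  induction k with
  | zero => simp
  | succ k ih =>
    rw [Function.iterate_succ, Set.preimage_comp,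
      cantorMeasure_shift_preimage (measurable_shift.iterate k hA), ih]

/-- The set of sequences with prefix `w`. -/
def wordCylinder (w : List Bool) : Set Cantor := {x | initSeg x w.length = w}

theorem wordCylinder_cons (b : Bool) (w : List Bool) :
    wordCylinder (b :: w) = {x | x 0 = b} ∩ shift ⁻¹' wordCylinder w := by
  ext x
  simp [wordCylinder, initSeg_succ]
  exact fun _ => Iff.rfl

theorem measurableSet_wordCylinder (w : List Bool) : MeasurableSet (wordCylinder w) := by
  induction w with
  | nil => simp [wordCylinder, initSeg_zero]
  | cons b w ih =>
    rw [wordCylinder_cons]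
    exact (measurableSet_head b).inter (measurable_shift ih)

theorem cantorMeasure_wordCylinder_inter_shift (w : List Bool) {A : Set Cantor}
    (hA : MeasurableSet A) :
    cantorMeasure (wordCylinder w ∩ shift^[w.length] ⁻¹' A) =
      2⁻¹ ^ w.length * cantorMeasure A := by
  induction w with
  | nil => simp [wordCylinder, initSeg_zero]
  | cons b w ih =>
    rw [wordCylinder_cons, List.length_cons, Function.iterate_succ, Set.preimage_comp,
      Set.inter_assoc, ← Set.preimage_inter, cantorMeasure_head_inter_shift, ih, pow_succ']
    · ring
    · exact (measurableSet_wordCylinder w).inter (measurable_shift.iterate _ hA)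

/-- The sequences none of whose first `m` blocks of length `w.length` equals `w`. -/
def blockAvoiding (w : List Bool) (m : ℕ) : Set Cantor :=
  {x | ∀ j < m, initSeg (shift^[w.length * j] x) w.length ≠ w}

theorem blockAvoiding_succ (w : List Bool) (m : ℕ) :
    blockAvoiding w (m + 1) = shift^[w.length] ⁻¹' blockAvoiding w m \ wordCylinder w := by
  ext x
  simp only [blockAvoiding, Set.mem_sdiff, Set.mem_preimage, Set.mem_ofPred_eq, wordCylinder,
    ← Function.iterate_add_apply]
  constructor
  · intro h
    exact ⟨fun j hj => by simpa [Nat.mul_succ] using h (j + 1) (by omega),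
      by simpa using h 0 (by omega)⟩
  · rintro ⟨h1, h2⟩ j hj
    cases j with
    | zero => simpa using h2
    | succ j => simpa [Nat.mul_succ] using h1 j (by omega)

theorem measurableSet_blockAvoiding (w : List Bool) (m : ℕ) :
    MeasurableSet (blockAvoiding w m) := by
  induction m with
  | zero => simp [blockAvoiding]
  | succ m ih =>
    rw [blockAvoiding_succ]
    exact (measurable_shift.iterate _ ih).diff (measurableSet_wordCylinder w)

/-- The first block is independent of the rest, so each further block multiplies the measure by the
probability of missing `w`. -/
theorem cantorMeasure_blockAvoiding (w : List Bool) (m : ℕ) :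
    cantorMeasure (blockAvoiding w m) = (1 - 2⁻¹ ^ w.length) ^ m := by
  induction m with
  | zero => simp [blockAvoiding]
  | succ m ih =>
    have hm := measurableSet_blockAvoiding w m
    rw [blockAvoiding_succ, ← Set.sdiff_inter_self_eq_sdiff, MeasureTheory.measure_sdiff
      Set.inter_subset_right
      ((measurableSet_wordCylinder w).inter (measurable_shift.iterate _ hm)).nullMeasurableSet
      (MeasureTheory.measure_ne_top _ _), cantorMeasure_wordCylinder_inter_shift w hm,
      cantorMeasure_shift_iterate_preimage _ hm, ih, pow_succ', ENNReal.sub_mul, one_mul]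
    intro _ _
    exact ENNReal.pow_ne_top (by simp)


/-! ### Random sequences -/

/-- A random sequence escapes some level of every Martin-Löf test given by a primitive recursive
enumeration of words. -/
theorem exists_forall_not_of_mem_MLR {x : Cantor} (hx : x ∈ MLR) {R : ℕ → List Bool → ℕ → Prop}
    (hR : PrimrecPred fun z : ℕ × List Bool × ℕ => R z.1 z.2.1 z.2.2)
    (hm : ∀ i, cantorMeasure {y | ∃ n s, R i (initSeg y n) s} ≤ 2⁻¹ ^ i) :
    ∃ i, ∀ n s, ¬ R i (initSeg x n) s := by
  have h := hx (fun i => ⟨_, isOpen_setOf_exists_initSeg (R i)⟩)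
    ⟨isComputable_of_primrec hR fun i x => Iff.rfl, hm⟩
  simpa using h

theorem initSeg_shift (x : Cantor) (n : ℕ) : initSeg (shift x) n = (initSeg x (n + 1)).tail := by
  rw [initSeg_succ]; rfl

theorem initSeg_cons (b : Bool) (x : Cantor) (n : ℕ) :
    initSeg (cons b x) (n + 1) = b :: initSeg x n :=
  initSeg_succ _ _

/-- The shift preserves the measure, so it pulls tests back to tests. -/
theorem shift_mem_MLR {x : Cantor} (hx : x ∈ MLR) : shift x ∈ MLR := by
  intro V hV hxV
  obtain ⟨R, hR, hRV⟩ := exists_primrec_of_isComputable hV.1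
  have hset : ∀ i, {y : Cantor | ∃ n s, R i (initSeg y n).tail s} =
      shift ⁻¹' (V i : Set Cantor) := by
    intro i
    ext y
    simp only [Set.mem_ofPred_eq, Set.mem_preimage, SetLike.mem_coe, hRV]
    constructor
    · rintro ⟨n, s, h⟩
      cases n with
      | zero => exact ⟨0, s, h⟩
      | succ n => exact ⟨n, s, by rwa [initSeg_shift]⟩
    · rintro ⟨n, s, h⟩
      exact ⟨n + 1, s, by rwa [← initSeg_shift]⟩
  obtain ⟨i, hi⟩ := exists_forall_not_of_mem_MLR hx (R := fun i w s => R i w.tail s)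
    (hR.comp (Primrec.pair Primrec.fst (Primrec.pair (Primrec.list_tail.comp
      (Primrec.fst.comp Primrec.snd)) (Primrec.snd.comp Primrec.snd)))) (fun i => by
      rw [hset, cantorMeasure_shift_preimage (V i).isOpen.measurableSet]
      exact hV.2 i)
  have : x ∈ shift ⁻¹' (V i : Set Cantor) := Set.mem_iInter.1 hxV i
  rw [← hset] at this
  obtain ⟨n, s, h⟩ := this
  exact hi n s h

/-- Pulling back along `cons b` at most doubles the measure; using level `i + 1` of the test absorbs
the factor. -/
theorem cons_mem_MLR {x : Cantor} (b : Bool) (hx : x ∈ MLR) : cons b x ∈ MLR := by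
  intro V hV hxV
  obtain ⟨R, hR, hRV⟩ := exists_primrec_of_isComputable hV.1
  -- The empty word is the only prefix of `cons b y` not of the form `b :: _`, hence the second
  -- disjunct.
  have hset : ∀ i, {y : Cantor | ∃ n s, R (i + 1) (b :: initSeg y n) s ∨ R (i + 1) [] s} =
      cons b ⁻¹' (V (i + 1) : Set Cantor) := by
    intro i
    ext y
    simp only [Set.mem_ofPred_eq, Set.mem_preimage, SetLike.mem_coe, hRV]
    constructor
    · rintro ⟨n, s, h | h⟩
      · exact ⟨n + 1, s, by rwa [initSeg_cons]⟩
      · exact ⟨0, s, h⟩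
    · rintro ⟨n, s, h⟩
      cases n with
      | zero => exact ⟨0, s, Or.inr h⟩
      | succ n => exact ⟨n, s, Or.inl (by rwa [← initSeg_cons])⟩
  have h1 : Primrec fun z : ℕ × List Bool × ℕ => z.1 + 1 := Primrec.succ.comp Primrec.fst
  have h2 : Primrec fun z : ℕ × List Bool × ℕ => z.2.2 := Primrec.snd.comp Primrec.snd
  obtain ⟨i, hi⟩ := exists_forall_not_of_mem_MLR hx
    (R := fun i w s => R (i + 1) (b :: w) s ∨ R (i + 1) [] s)
    (PrimrecPred.or (hR.comp (Primrec.pair h1 (Primrec.pair (Primrec.list_cons.comp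
      (Primrec.const b) (Primrec.fst.comp Primrec.snd)) h2)))
      (hR.comp (Primrec.pair h1 (Primrec.pair (Primrec.const []) h2)))) (fun i => by
      rw [hset]
      refine (cantorMeasure_cons_preimage_le b (V (i + 1)).isOpen.measurableSet).trans ?_
      calc 2 * cantorMeasure (V (i + 1) : Set Cantor) ≤ 2 * 2⁻¹ ^ (i + 1) := by
            gcongr; exact hV.2 _
        _ = 2⁻¹ ^ i := by
            rw [pow_succ', ← mul_assoc, ENNReal.mul_inv_cancel (by simp) (by simp), one_mul])
  have : x ∈ cons b ⁻¹' (V (i + 1) : Set Cantor) := Set.mem_iInter.1 hxV (i + 1)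
  rw [← hset] at this
  obtain ⟨n, s, h⟩ := this
  exact hi n s h

theorem shift_mem_MLR_iff {x : Cantor} : shift x ∈ MLR ↔ x ∈ MLR :=
  ⟨fun h => cons_shift x ▸ cons_mem_MLR _ h, shift_mem_MLR⟩

theorem shift_iterate_mem_MLR_iff {x : Cantor} (n : ℕ) : shift^[n] x ∈ MLR ↔ x ∈ MLR := by
  induction n with
  | zero => rfl
  | succ n ih => rw [Function.iterate_succ_apply', shift_mem_MLR_iff, ih]

/-- Randomness is invariant under modifying finitely many bits. -/
theorem mem_MLR_of_eventually_eq {x y : Cantor} (hx : x ∈ MLR) {m : ℕ}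
    (h : ∀ i, m ≤ i → y i = x i) : y ∈ MLR := by
  rw [← shift_iterate_mem_MLR_iff m] at hx ⊢
  convert hx using 1
  funext i
  rw [shift_iterate_apply, shift_iterate_apply, h _ (by omega)]

theorem initSeg_shift_iterate (x : Cantor) {k l n : ℕ} (h : k + l ≤ n) :
    initSeg (shift^[k] x) l = ((initSeg x n).drop k).take l := by
  apply List.ext_getElem
  · simp; omega
  · intro i h1 h2
    simp [initSeg, shift_iterate_apply]

/-- The orbit of a random sequence under the shift visits every cylinder. -/
theorem exists_shift_iterate_mem_wordCylinder {x : Cantor} (hx : x ∈ MLR) (w : List Bool) :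
    ∃ n, shift^[n] x ∈ wordCylinder w := by
  by_contra! hcon
  have hlt : (1 - 2⁻¹ ^ w.length : ℝ≥0∞) < 1 :=
    ENNReal.sub_lt_self (by simp) (by simp) (by simp)
  -- With `c` blocks per level, avoiding `w` in the first `c * i` blocks has measure at most 2^(-i),
  -- which is a test.
  obtain ⟨c, hc⟩ : ∃ c : ℕ, (1 - 2⁻¹ ^ w.length : ℝ≥0∞) ^ c < 2⁻¹ :=
    ((ENNReal.tendsto_pow_atTop_nhds_zero_of_lt_one hlt).eventually_lt_const (by simp)).exists
  let R : ℕ → List Bool → ℕ → Prop := fun i v _ => v.length = w.length * (c * i) ∧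
    ∀ j < c * i, (v.drop (w.length * j)).take w.length ≠ w
  have hset : ∀ i, {y : Cantor | ∃ n s, R i (initSeg y n) s} = blockAvoiding w (c * i) := by
    intro i
    have key : ∀ y : Cantor, ∀ j < c * i, initSeg (shift^[w.length * j] y) w.length =
        ((initSeg y (w.length * (c * i))).drop (w.length * j)).take w.length := by
      intro y j hj
      apply initSeg_shift_iterate
      rw [← Nat.mul_succ]
      exact Nat.mul_le_mul_left _ hj
    ext y
    constructor
    · rintro ⟨n, s, h1, h2⟩ j hj
      rw [length_initSeg] at h1
      rw [key y j hj, ← h1]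
      exact h2 j hj
    · intro h
      refine ⟨w.length * (c * i), 0, length_initSeg _ _, fun j hj => ?_⟩
      rw [← key y j hj]
      exact h j hj
  have hci : Primrec fun z : ℕ × List Bool × ℕ => c * z.1 :=
    Primrec.nat_mul.comp (Primrec.const c) Primrec.fst
  obtain ⟨i, hi⟩ := exists_forall_not_of_mem_MLR hx (R := R) (by
    refine PrimrecPred.and (Primrec.eq.comp (Primrec.list_length.comp
      (Primrec.fst.comp Primrec.snd)) (Primrec.nat_mul.comp (Primrec.const _) hci))
      (primrecPred_forall_lt hci (PrimrecPred.not (Primrec.eq.comp ?_ (Primrec.const w))))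
    exact Primrec.list_take.comp (Primrec.const _) (Primrec.list_drop.comp
      (Primrec.nat_mul.comp (Primrec.const _) Primrec.fst)
      (Primrec.fst.comp (Primrec.snd.comp Primrec.snd)))) (fun i => by
      rw [hset, cantorMeasure_blockAvoiding, pow_mul]
      gcongr)
  have : x ∈ blockAvoiding w (c * i) := fun j _ => hcon _
  rw [← hset] at this
  obtain ⟨n, s, h⟩ := this
  exact hi n s h

theorem exists_wordCylinder_subset {U : Set Cantor} (hU : IsOpen U) {x : Cantor} (hx : x ∈ U) :
    ∃ n, wordCylinder (initSeg x n) ⊆ U := by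
  obtain ⟨V, ⟨y, n, rfl⟩, h1, h2⟩ :=
    (PiNat.isTopologicalBasis_cylinders (fun _ : ℕ => Bool)).exists_subset_of_mem_open hx hU
  refine ⟨n, fun z hz => h2 fun i hi => ?_⟩
  rw [wordCylinder, Set.mem_ofPred_eq, length_initSeg, initSeg_eq_iff] at hz
  rw [hz i hi, h1 i hi]

theorem exists_shift_iterate_mem {x : Cantor} (hx : x ∈ MLR) {U : Set Cantor} (hU : IsOpen U)
    (hne : U.Nonempty) : ∃ n, shift^[n] x ∈ U := by
  obtain ⟨y, hy⟩ := hne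
  obtain ⟨n, hn⟩ := exists_wordCylinder_subset hU hy
  obtain ⟨k, hk⟩ := exists_shift_iterate_mem_wordCylinder hx (initSeg y n)
  exact ⟨k, hn hk⟩

/-- A periodic orbit never enters the nonempty open set of sequences whose entries at 0 and `d`
differ. -/
theorem not_mem_MLR_of_periodic {x : Cantor} {d : ℕ} (hd : 0 < d) (h : ∀ i, x (d + i) = x i) :
    x ∉ MLR := by
  intro hx
  obtain ⟨n, hn⟩ := exists_shift_iterate_mem hx
    (U := {y : Cantor | y d ≠ y 0}) (isOpen_ne_fun (continuous_apply d) (continuous_apply 0))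
    ⟨fun i => decide (i = 0), by simp [hd.ne']⟩
  apply hn
  rw [shift_iterate_apply, shift_iterate_apply, add_zero, add_comm, h]

/-- The shift orbit of a random sequence is injective. -/
theorem shift_iterate_injective {x : Cantor} (hx : x ∈ MLR) :
    Function.Injective fun n => shift^[n] x := by
  suffices h : ∀ i j, i < j → shift^[i] x ≠ shift^[j] x by
    intro i j hij
    by_contra hne
    rcases lt_or_gt_of_ne hne with h1 | h1
    · exact h i j h1 hij
    · exact h j i h1 hij.symm
  intro i j hij h
  refine not_mem_MLR_of_periodic (x := shift^[i] x) (d := j - i) (by omega) (fun k => ?_)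
    ((shift_iterate_mem_MLR_iff i).2 hx)
  have := congrFun h k
  rw [shift_iterate_apply, shift_iterate_apply] at this ⊢
  rw [this]; congr 1; omega

theorem not_mem_MLR_of_eventually_false {x : Cantor} {m : ℕ} (h : ∀ i, m ≤ i → x i = false) :
    x ∉ MLR := by
  intro hx
  refine not_mem_MLR_of_periodic (x := shift^[m] x) one_pos (fun k => ?_)
    ((shift_iterate_mem_MLR_iff m).2 hx)
  rw [shift_iterate_apply, shift_iterate_apply, h _ (by omega), h _ (by omega)]

theorem mem_of_not_mem_MLR {U : ℕ → TopologicalSpace.Opens Cantor} (hU : IsUniversalMLTest U)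
    {x : Cantor} (hx : x ∉ MLR) (i : ℕ) : x ∈ U i := by
  rw [MLR_eq hU, Set.mem_compl_iff, not_not] at hx
  exact Set.mem_iInter.1 hx i

theorem exists_not_mem {U : ℕ → TopologicalSpace.Opens Cantor} (hU : IsMLTest U) :
    ∃ x, x ∉ U 1 := by
  by_contra! h
  have h1 := hU.2 1
  rw [show (U 1 : Set Cantor) = Set.univ from Set.eq_univ_of_forall h,
    MeasureTheory.measure_univ, pow_one] at h1
  exact absurd h1 (by simp)

theorem exists_mem_MLR_not_mem {U : ℕ → TopologicalSpace.Opens Cantor}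
    (hU : IsUniversalMLTest U) : ∃ x ∈ MLR, x ∉ U 1 := by
  obtain ⟨x, hx⟩ := exists_not_mem hU.1
  exact ⟨x, by_contra fun h => hx (mem_of_not_mem_MLR hU h 1), hx⟩

/-- The levels of a universal test are dense in the set of random sequences. -/
theorem exists_mem_MLR_inter {U : ℕ → TopologicalSpace.Opens Cantor} (hU : IsUniversalMLTest U)
    (k : ℕ) {x : Cantor} (hx : x ∈ MLR) {O : Set Cantor} (hO : IsOpen O) (hxO : x ∈ O) :
    ∃ z ∈ MLR, z ∈ O ∧ z ∈ U k := by
  obtain ⟨n, hn⟩ := exists_wordCylinder_subset hO hxO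
  -- Truncating `x` to zeros leaves the random sequences and so enters `U k`. A finite prefix
  -- witnesses this; after it one may return to the bits of `x` and be random again.
  let y : Cantor := fun i => if i < n then x i else false
  have hy : y ∈ U k := mem_of_not_mem_MLR hU
    (not_mem_MLR_of_eventually_false (m := n) fun i hi => by simp [y, hi.not_gt]) k
  obtain ⟨m, hm⟩ := exists_wordCylinder_subset (U k).isOpen hy
  refine ⟨fun i => if i < n ⊔ m then y i else x i, mem_MLR_of_eventually_eq hx (m := n ⊔ m)
    fun i hi => by simp [hi.not_gt], hn ?_, hm ?_⟩
  · rw [wordCylinder, Set.mem_ofPred_eq, length_initSeg, initSeg_eq_iff]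
    intro i hi
    simp [y, hi]
  · rw [wordCylinder, Set.mem_ofPred_eq, length_initSeg, initSeg_eq_iff]
    intro i hi
    simp [hi]


/-! ### Names of instances and solutions of `d_MLR × LPO*` -/

/-- The position, in a name of an instance of `d_MLR × LPO*`, of the digit `m` of the `k`-th
instance of `LPO`, counted from the outermost one. -/
def digitIdx (k m : ℕ) : ℕ := 2 * (2 ^ k * (2 * m + 1) + 1) + 1

/-- The position of the `m`-th digit of the innermost component. -/
def baseIdx (n m : ℕ) : ℕ := 2 * (2 ^ n * m + 1) + 1

theorem two_pow_mul_odd_inj {k l m n : ℕ} (h : 2 ^ k * (2 * m + 1) = 2 ^ l * (2 * n + 1)) :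
    k = l := by
  induction k generalizing l with
  | zero =>
    cases l with
    | zero => rfl
    | succ l => rw [pow_succ] at h; ring_nf at h; omega
  | succ k ih =>
    cases l with
    | zero => rw [pow_succ] at h; ring_nf at h; omega
    | succ l =>
      rw [ih (l := l)]
      apply Nat.eq_of_mul_eq_mul_left two_pos
      rw [← mul_assoc, ← mul_assoc, ← pow_succ', ← pow_succ', h]

theorem digitIdx_inj {k l m n : ℕ} (h : digitIdx k m = digitIdx l n) : k = l :=
  two_pow_mul_odd_inj (m := m) (n := n) (by simp only [digitIdx] at h; omega)

theorem baseIdx_ne_digitIdx {k n : ℕ} (h : k < n) (m : ℕ) : baseIdx n m ≠ digitIdx k 0 := by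
  intro he
  have h1 : 2 ^ n * m = 2 ^ k := by simp only [baseIdx, digitIdx] at he; omega
  rcases Nat.eq_zero_or_pos m with rfl | hm
  · rw [mul_zero] at h1
    exact absurd h1 (by positivity)
  · have := Nat.pow_lt_pow_right one_lt_two h
    have := Nat.le_mul_of_pos_right (2 ^ n) hm
    omega

theorem lt_digitIdx_left (k m : ℕ) : k < digitIdx k m := by
  have : k < 2 ^ k := Nat.lt_two_pow_self
  have : 2 ^ k ≤ 2 ^ k * (2 * m + 1) := Nat.le_mul_of_pos_right _ (by omega)
  simp only [digitIdx]; omega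

theorem lt_digitIdx_right (k m : ℕ) : m < digitIdx k m := by
  have : 2 * m + 1 ≤ 2 ^ k * (2 * m + 1) := Nat.le_mul_of_pos_left _ (by positivity)
  simp only [digitIdx]; omega

theorem digitIdx_mod_two (k m : ℕ) : digitIdx k m % 2 = 1 := by simp only [digitIdx]; omega

theorem three_lt_digitIdx (k m : ℕ) : 3 < digitIdx k m := by
  have : 0 < 2 ^ k * (2 * m + 1) := by positivity
  simp only [digitIdx]; omega

theorem exists_isName_powSpace (n : ℕ) (u : Baire) :
    ∃ x : PowSpace Baire n, Represented.IsName u x := by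
  induction n generalizing u with
  | zero => exact ⟨u, rfl⟩
  | succ n ih =>
    obtain ⟨x, hx⟩ := ih (fstPart u)
    exact ⟨(x, sndPart u), hx, rfl⟩

open Classical in
-- The outermost instance occupies the odd positions and the remaining ones the even positions.
-- Iterating, the k-th instance sits at the positions 2^k(2m+1) and the innermost Baire component at
-- the multiples of 2^n. An answer is constrained only at the first of its positions, 2^k.
theorem exists_mem_mvPow_LPO_iff (n : ℕ) (u v : Baire) (x : PowSpace Baire n)
    (hx : Represented.IsName u x) :
    (∃ y ∈ mvPow LPO n x, Represented.IsName v y) ↔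
      (∀ k < n, v (2 ^ k) = if ∀ m, u (2 ^ k * (2 * m + 1)) = 0 then 1 else 0) ∧
        ∀ m, v (2 ^ n * m) = u (2 ^ n * m) := by
  induction n generalizing u v with
  | zero =>
    have hx : u = x := hx
    constructor
    · rintro ⟨y, hy, hv⟩
      have hv : v = y := hv
      have hy : y = x := hy
      simp [hv, hy, hx]
    · rintro ⟨-, h⟩
      exact ⟨x, rfl, by
        change v = x
        rw [← hx]; funext m; simpa using h m⟩
  | succ n ih =>
    obtain ⟨hx1, hx2⟩ := hx
    have hx2 : sndPart u = x.2 := hx2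
    have e1 := ih (fstPart u) (fstPart v) x.1 hx1
    have e2 : (∃ b ∈ LPO x.2, Represented.IsName (sndPart v) b) ↔
        v 1 = if ∀ m, u (2 * m + 1) = 0 then 1 else 0 := by
      have hz : x.2 = (fun _ => 0) ↔ ∀ m, u (2 * m + 1) = 0 := by
        rw [← hx2]; exact funext_iff
      have hb : ∀ b : ({0, 1} : Set ℕ), Represented.IsName (sndPart v) b ↔ v 1 = b :=
        fun b => Iff.rfl
      simp only [hb, LPO, Set.mem_ofPred_eq, ne_eq, hz]
      by_cases h : ∀ m, u (2 * m + 1) = 0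
      · rw [if_pos h]
        constructor
        · rintro ⟨b, hb | hb, e⟩
          · rw [e, hb.2]
          · exact absurd h hb.1
        · intro e
          exact ⟨⟨1, by simp⟩, Or.inl ⟨h, rfl⟩, e⟩
      · rw [if_neg h]
        constructor
        · rintro ⟨b, hb | hb, e⟩
          · exact absurd hb.1 h
          · rw [e, hb.2]
        · intro e
          exact ⟨⟨0, by simp⟩, Or.inr ⟨h, rfl⟩, e⟩
    have e3 : (∃ y ∈ mvPow LPO (n + 1) x, Represented.IsName v y) ↔
        (∃ y ∈ mvPow LPO n x.1, Represented.IsName (fstPart v) y) ∧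
          ∃ b ∈ LPO x.2, Represented.IsName (sndPart v) b := by
      constructor
      · rintro ⟨y, hy, hv⟩
        exact ⟨⟨y.1, hy.1, hv.1⟩, y.2, hy.2, hv.2⟩
      · rintro ⟨⟨y, hy, hv⟩, b, hb, hb'⟩
        exact ⟨(y, b), ⟨hy, hb⟩, hv, hb'⟩
    rw [e3, e1, e2]
    have h4 : ∀ k a, 2 * (2 ^ k * a) = 2 ^ (k + 1) * a := fun k a => by rw [pow_succ']; ring
    simp only [fstPart, h4, ← pow_succ']
    constructor
    · rintro ⟨⟨h1, h2⟩, h3⟩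
      refine ⟨fun k hk => ?_, h2⟩
      cases k with
      | zero => simpa using h3
      | succ k => exact h1 k (by omega)
    · rintro ⟨h1, h2⟩
      exact ⟨⟨fun k hk => h1 (k + 1) (by omega), h2⟩, by simpa using h1 0 (by omega)⟩

open Classical in
/-- `r` is a name of a solution of the instance of `d_MLR × LPO*` named by `p`. -/
def Solves (p r : Baire) : Prop :=
  r 0 = 1 ∧ r 1 = p 1 ∧
    (∀ k < p 1, r (digitIdx k 0) = if ∀ m, p (digitIdx k m) = 0 then 1 else 0) ∧
    ∀ m, r (baseIdx (p 1) m) = p (baseIdx (p 1) m)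

theorem exists_mem_dMap_prod_star_iff {p r : Baire} {z : MLR × Σ n, PowSpace Baire n}
    (hz : Represented.IsName p z) :
    (∃ y ∈ mvProd (dMap MLR) (mvStar LPO) z, Represented.IsName r y) ↔ Solves p r := by
  obtain ⟨x, n, w⟩ := z
  obtain ⟨-, hn, hw⟩ := hz
  have hn : p 1 = n := hn
  subst hn
  have key := exists_mem_mvPow_LPO_iff _ (fun i => sndPart p (i + 1))
    (fun i => sndPart r (i + 1)) w hw
  have e : (∃ y ∈ mvProd (dMap MLR) (mvStar LPO) (x, ⟨p 1, w⟩), Represented.IsName r y) ↔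
      r 0 = 1 ∧ r 1 = p 1 ∧
        ∃ y ∈ mvPow LPO (p 1) w, Represented.IsName (fun i => sndPart r (i + 1)) y := by
    constructor
    · rintro ⟨⟨a, b⟩, ⟨ha, c, hc, rfl⟩, ha', hb, hb'⟩
      have ha : a = ⟨1, rfl⟩ := ha
      have ha' : r 0 = a := ha'
      rw [ha] at ha'
      exact ⟨ha', hb, c, hc, hb'⟩
    · rintro ⟨h0, h1, c, hc, hc'⟩
      exact ⟨(⟨1, rfl⟩, ⟨p 1, c⟩), ⟨rfl, c, hc, rfl⟩, h0, h1, hc'⟩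
  rw [e, key]
  simp only [Solves, sndPart, digitIdx, baseIdx, mul_zero, zero_add, mul_one]
  congr!

theorem exists_isName_prod {p : Baire} {x : Cantor} (hx : x ∈ MLR)
    (hp : ∀ i, p (2 * i) = (x i).toNat) :
    ∃ z : MLR × Σ n, PowSpace Baire n, Represented.IsName p z := by
  obtain ⟨w, hw⟩ := exists_isName_powSpace (p 1) (fun i => sndPart p (i + 1))
  exact ⟨(⟨x, hx⟩, ⟨p 1, w⟩), hp, rfl, hw⟩

/-- Only the even half of a name is restricted: any odd half names some instance of `LPO*`. -/
theorem realizes_dMap_prod_star_iff {G : Baire →. Baire} :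
    Realizes G (mvProd (dMap MLR) (mvStar LPO)) ↔
      ∀ p, ∀ x ∈ MLR, (∀ i, p (2 * i) = (x i).toNat) → ∃ r ∈ G p, Solves p r := by
  constructor
  · intro h p x hx hp
    obtain ⟨z, hz⟩ := exists_isName_prod hx hp
    obtain ⟨r, hr, hy⟩ := h p z hz
    exact ⟨r, hr, (exists_mem_dMap_prod_star_iff hz).1 hy⟩
  · intro h p z hz
    obtain ⟨r, hr, hs⟩ := h p z.1 z.1.2 hz.1
    exact ⟨r, hr, (exists_mem_dMap_prod_star_iff hz).2 hs⟩

theorem pairing_even (p q : Baire) (i : ℕ) : pairing p q (2 * i) = p i :=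
  congrFun (fstPart_pairing p q) i

theorem pairing_odd (p q : Baire) (i : ℕ) : pairing p q (2 * i + 1) = q i :=
  congrFun (sndPart_pairing p q) i

/-! ### Primitive recursive ingredients -/

theorem primrec_two_pow : Primrec fun n : ℕ => 2 ^ n := by
  refine (Primrec.nat_rec₁ (f := fun _ y => 2 * y) 1
    (Primrec.nat_double.comp Primrec.snd)).of_eq fun n => ?_
  induction n with
  | zero => rfl
  | succ n ih => rw [pow_succ', ← ih]

theorem primrec_digitIdx : Primrec₂ digitIdx := by
  refine Primrec.nat_double_succ.comp (Primrec.succ.comp (Primrec.nat_mul.comp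
    (primrec_two_pow.comp Primrec.fst) (Primrec.nat_double_succ.comp Primrec.snd)))

/-- The word of length `l` starting at position `k` in the sequence coded by the even positions
of `u`. -/
def evenWord (u : List ℕ) (k l : ℕ) : List Bool :=
  (List.range l).map fun j => decide (u.getD (2 * (k + j)) 0 ≠ 0)

theorem primrec_evenWord : Primrec fun z : List ℕ × ℕ × ℕ => evenWord z.1 z.2.1 z.2.2 := by
  refine Primrec.list_map (Primrec.list_range.comp (Primrec.snd.comp Primrec.snd)) ?_
  refine PrimrecPred.decide (PrimrecPred.not (Primrec.eq.comp ((Primrec.list_getD 0).comp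
    (Primrec.fst.comp Primrec.fst) (Primrec.nat_double.comp (Primrec.nat_add.comp
    (Primrec.fst.comp (Primrec.snd.comp Primrec.fst)) Primrec.snd))) (Primrec.const 0)))

/-- The bound is demanded only for nonempty words because later lengths come from truncated
subtraction and may be 0 with `k` large. -/
theorem evenWord_initSeg {p : Baire} {x : Cantor} (hp : ∀ i, p (2 * i) = (x i).toNat)
    {k l N : ℕ} (h : 0 < l → 2 * (k + l) ≤ N) :
    evenWord (initSeg p N) k l = initSeg (shift^[k] x) l := by
  refine List.map_congr_left fun j hj => ?_
  have hj := List.mem_range.1 hj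
  rw [getD_initSeg _ _ (by omega), hp, shift_iterate_apply]
  cases x (k + j) <;> simp


/-! ### Hitting times reduce to `d_MLR × LPO*` -/

/-- The prefix `u` of a name of `(x, U)` shows that the `k`-th shift of `x` lies in `U`. -/
def ShowsHit (u : List ℕ) (k : ℕ) : Prop :=
  ∃ s < u.length, ∃ l < u.length + 1, 2 * (k + l) ≤ u.length ∧
    u.getD (2 * s + 1) 0 = Encodable.encode (evenWord u k l) + 1

theorem primrecRel_showsHit : PrimrecRel ShowsHit := by
  refine primrecPred_exists_lt (Primrec.list_length.comp Primrec.fst) ?_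
  refine primrecPred_exists_lt
    (Q := fun l (z : ℕ × List ℕ × ℕ) => 2 * (z.2.2 + l) ≤ z.2.1.length ∧
      z.2.1.getD (2 * z.1 + 1) 0 = Encodable.encode (evenWord z.2.1 z.2.2 l) + 1)
    (Primrec.succ.comp (Primrec.list_length.comp (Primrec.fst.comp Primrec.snd))) ?_
  have hu : Primrec fun z : ℕ × ℕ × List ℕ × ℕ => z.2.2.1 :=
    Primrec.fst.comp (Primrec.snd.comp Primrec.snd)
  have hk : Primrec fun z : ℕ × ℕ × List ℕ × ℕ => z.2.2.2 :=
    Primrec.snd.comp (Primrec.snd.comp Primrec.snd)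
  refine PrimrecPred.and (Primrec.nat_le.comp (Primrec.nat_double.comp
    (Primrec.nat_add.comp hk Primrec.fst)) (Primrec.list_length.comp hu)) (Primrec.eq.comp ?_ ?_)
  · exact (Primrec.list_getD 0).comp hu (Primrec.nat_double_succ.comp
      (Primrec.fst.comp Primrec.snd))
  · exact Primrec.succ.comp (Primrec.encode.comp (primrec_evenWord.comp
      (Primrec.pair hu (Primrec.pair hk Primrec.fst))))

theorem mem_enumeratedOpen_of_showsHit {p : Baire} {x : Cantor}
    (hp : ∀ i, p (2 * i) = (x i).toNat) {N k : ℕ} (h : ShowsHit (initSeg p N) k) :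
    shift^[k] x ∈ enumeratedOpen (sndPart p) := by
  obtain ⟨s, -, l, -, hl, h⟩ := h
  rw [length_initSeg] at hl
  rw [evenWord_initSeg hp fun _ => hl] at h
  rcases lt_or_ge (2 * s + 1) N with hs | hs
  · rw [getD_initSeg _ _ hs] at h
    exact ⟨s, l, h⟩
  -- Beyond the prefix the default value is 0, which is never a code plus one.
  · rw [getD_initSeg_of_le _ _ hs] at h
    omega

theorem exists_forall_showsHit {p : Baire} {x : Cantor} (hp : ∀ i, p (2 * i) = (x i).toNat)
    {k : ℕ} (h : shift^[k] x ∈ enumeratedOpen (sndPart p)) :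
    ∃ N₀, ∀ N ≥ N₀, ShowsHit (initSeg p N) k := by
  obtain ⟨s, l, h⟩ := h
  refine ⟨2 * s + 2 * (k + l) + 2, fun N hN => ⟨s, ?_, l, ?_, ?_, ?_⟩⟩
  · rw [length_initSeg]; omega
  · rw [length_initSeg]; omega
  · rw [length_initSeg]; omega
  · rw [evenWord_initSeg hp fun _ => by omega, getD_initSeg _ _ (by omega)]
    exact h

open Classical in
/-- From a stage at which a hit is known, an instance of `LPO*` is produced whose `k`-th component
asks whether the `k`-th shift lies in the open set. -/
noncomputable def hitQuery (u' u : List ℕ) (i : ℕ) : ℕ :=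
  if i % 2 = 0 then u.getD i 0 else if i = 1 then u'.length else
    if ∃ k < i, ∃ m < i, i = digitIdx k m ∧ ShowsHit u k then 1 else 0

theorem primrec_hitQuery :
    Primrec fun z : List ℕ × List ℕ × ℕ => hitQuery z.1 z.2.1 z.2.2 := by
  classical
  have hi : Primrec fun z : List ℕ × List ℕ × ℕ => z.2.2 := Primrec.snd.comp Primrec.snd
  have hu : Primrec fun z : List ℕ × List ℕ × ℕ => z.2.1 := Primrec.fst.comp Primrec.snd
  refine Primrec.ite (Primrec.eq.comp (Primrec.nat_mod.comp hi (Primrec.const 2))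
    (Primrec.const 0)) ((Primrec.list_getD 0).comp hu hi) (Primrec.ite
    (Primrec.eq.comp hi (Primrec.const 1)) (Primrec.list_length.comp Primrec.fst)
    (Primrec.ite ?_ (Primrec.const 1) (Primrec.const 0)))
  refine primrecPred_exists_lt hi ?_
  refine primrecPred_exists_lt
    (Q := fun m (z : ℕ × List ℕ × List ℕ × ℕ) => z.2.2.2 = digitIdx z.1 m ∧ ShowsHit z.2.2.1 z.1)
    (hi.comp Primrec.snd) ?_
  have hk : Primrec fun z : ℕ × ℕ × List ℕ × List ℕ × ℕ => z.2.1 := Primrec.fst.comp Primrec.snd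
  exact PrimrecPred.and (Primrec.eq.comp (hi.comp (Primrec.snd.comp Primrec.snd))
    (primrec_digitIdx.comp hk Primrec.fst))
    (primrecRel_showsHit.comp (hu.comp (Primrec.snd.comp Primrec.snd)) hk)

/-- The stage N of the first verified hit serves as the number of questions; the hit occurs at a
time below N. The least k answered 0 is the hitting time. -/
theorem hittingTime_le :
    WReducible HittingTime (mvProd (dMap MLR) (mvStar LPO)) := by
  classical
  let P : List ℕ → Prop := fun u => ∃ k < u.length, ShowsHit u k
  have hP : PrimrecPred P :=
    primrecPred_exists_lt Primrec.list_length (primrecRel_showsHit.comp Primrec.snd Primrec.fst)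
  -- A prefix of length `2 * digitIdx k 0 + 2` of the paired input ends with the answer to question
  -- k. These lengths increase with k, so the first accepted prefix belongs to the least k answered
  -- 0, and `φK` recovers k from the length.
  let PK : List ℕ → Prop := fun u =>
    ∃ k < u.length, u.length = 2 * digitIdx k 0 + 2 ∧ u.getD (u.length - 1) 0 = 0
  let φK : List ℕ → List ℕ → ℕ → ℕ := fun u' _ _ =>
    Nat.findGreatest (fun k => u'.length = 2 * digitIdx k 0 + 2) u'.length
  have hd : Primrec fun k => 2 * digitIdx k 0 + 2 := Primrec.succ.comp (Primrec.succ.comp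
    (Primrec.nat_double.comp (primrec_digitIdx.comp Primrec.id (Primrec.const 0))))
  have hPK : PrimrecPred PK := by
    refine primrecPred_exists_lt Primrec.list_length (PrimrecPred.and (Primrec.eq.comp
      (Primrec.list_length.comp Primrec.snd) (hd.comp Primrec.fst)) (Primrec.eq.comp
      ((Primrec.list_getD 0).comp Primrec.snd (Primrec.pred.comp
        (Primrec.list_length.comp Primrec.snd))) (Primrec.const 0)))
  have hφK : Primrec fun z : List ℕ × List ℕ × ℕ => φK z.1 z.2.1 z.2.2 := by
    refine Primrec.nat_findGreatest (Primrec.list_length.comp Primrec.fst) ?_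
    exact Primrec.eq.comp (Primrec.list_length.comp (Primrec.fst.comp Primrec.fst))
      (hd.comp Primrec.snd)
  refine ⟨staged PK φK, staged P hitQuery, computableBaire_staged hPK hφK,
    computableBaire_staged hP primrec_hitQuery, fun G hG p z hz => ?_⟩
  rw [realizes_dMap_prod_star_iff] at hG
  obtain ⟨⟨x, hx⟩, ⟨U, hU⟩⟩ := z
  have hp : ∀ i, p (2 * i) = (x i).toNat := hz.1
  have hpU : enumeratedOpen (sndPart p) = U := hz.2
  obtain ⟨n₀, hn₀⟩ := exists_shift_iterate_mem hx U.isOpen hU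
  have hex : ∃ N, P (initSeg p N) := by
    rw [← hpU] at hn₀
    obtain ⟨N, hN⟩ := exists_forall_showsHit hp hn₀
    exact ⟨max N (n₀ + 1), n₀, by rw [length_initSeg]; omega, hN _ (le_max_left _ _)⟩
  obtain ⟨r, hr⟩ := exists_mem_staged hitQuery hex
  obtain ⟨N, hN, hr'⟩ := mem_staged.1 hr
  have hr0 : ∀ i, r (2 * i) = (x i).toNat := by
    intro i
    rw [hr', hitQuery, if_pos (by omega), getD_initSeg _ _ (by omega), hp]
  have hr1 : r 1 = N := by simp [hr', hitQuery]
  have hrd : ∀ k, (∀ m, r (digitIdx k m) = 0) ↔ shift^[k] x ∉ U := by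
    intro k
    have e : ∀ m, r (digitIdx k m) = 0 ↔ ¬ ShowsHit (initSeg p (2 * digitIdx k m + 2)) k := by
      intro m
      have h1 := digitIdx_mod_two k m
      have h3 := three_lt_digitIdx k m
      rw [hr', hitQuery, if_neg (by omega), if_neg (by omega)]
      split_ifs with h
      · obtain ⟨k', -, m', -, h', hs⟩ := h
        obtain rfl := digitIdx_inj h'
        simpa using hs
      · simp only [true_iff]
        intro hs
        exact h ⟨k, lt_digitIdx_left k m, m, lt_digitIdx_right k m, rfl, hs⟩
    simp only [e]
    rw [← SetLike.mem_coe, ← hpU]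
    constructor
    · intro h hk
      obtain ⟨M, hM⟩ := exists_forall_showsHit hp hk
      -- Digit M of the k-th instance is computed from a prefix longer than M, by which time the hit
      -- has been verified.
      exact h M (hM _ (by have := lt_digitIdx_right k M; omega))
    · intro h m hm
      exact h (mem_enumeratedOpen_of_showsHit hp hm)
  obtain ⟨q, hq, -, hq1, hqd, -⟩ := hG r x hx hr0
  rw [hr1] at hq1 hqd
  simp only [hrd] at hqd
  have hlt : ∃ k < N, shift^[k] x ∈ U := by
    obtain ⟨k, hk, hk'⟩ := hN.1
    exact ⟨k, by rwa [length_initSeg] at hk, by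
      rw [← SetLike.mem_coe, ← hpU]
      exact mem_enumeratedOpen_of_showsHit hp hk'⟩
  have hhit : ∃ k, shift^[k] x ∈ U := hlt.imp fun k hk => hk.2
  have hfN : Nat.find hhit < N := by
    obtain ⟨k, hk, hk'⟩ := hlt
    exact (Nat.find_min' hhit hk').trans_lt hk
  have hget : ∀ k, (initSeg (pairing p q) (2 * digitIdx k 0 + 2)).getD
      (2 * digitIdx k 0 + 2 - 1) 0 = q (digitIdx k 0) := by
    intro k
    rw [getD_initSeg _ _ (by omega), ← pairing_odd p q]
    rfl
  set n := Nat.find hhit with hn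
  have hs : (fun _ => n) ∈ staged PK φK (pairing p q) := by
    refine mem_staged.2 ⟨2 * digitIdx n 0 + 2, ⟨⟨n, ?_, ?_, ?_⟩, ?_⟩, fun i => ?_⟩
    · rw [length_initSeg]; have := lt_digitIdx_left n 0; omega
    · rw [length_initSeg]
    · rw [length_initSeg, hget, hqd n hfN, if_neg (not_not.2 (Nat.find_spec hhit))]
    · rintro j hj ⟨k, -, hk, hk'⟩
      rw [length_initSeg] at hk hk'
      subst hk
      have hkn : k < n := by
        have h2 : 2 ^ k < 2 ^ n := by simp only [digitIdx] at hj; omega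
        exact (Nat.pow_lt_pow_iff_right one_lt_two).1 h2
      rw [hget, hqd k (hkn.trans hfN), if_pos (Nat.find_min hhit hkn)] at hk'
      exact one_ne_zero hk'
    · simp only [φK, length_initSeg]
      have h1 := Nat.findGreatest_spec (P := fun k => 2 * digitIdx n 0 + 2 = 2 * digitIdx k 0 + 2)
        (n := 2 * digitIdx n 0 + 2) (m := n) (by have := lt_digitIdx_left n 0; omega) rfl
      exact digitIdx_inj (m := 0) (n := 0) (by omega)
  refine ⟨fun _ => n, Part.mem_bind hr (Part.mem_bind hq hs), n, ?_, rfl⟩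
  exact ⟨Nat.find_spec hhit, fun m hm => Nat.find_min' hhit hm⟩


/-! ### Reading off solutions of `LPO*` from a finite stage -/

/-- The prefix `u` of an instance of `d_MLR × LPO*` shows that the `k`-th instance of `LPO` has a
nonzero digit. -/
def Seen (u : List ℕ) (k : ℕ) : Prop := ∃ m < u.length, u.getD (digitIdx k m) 0 ≠ 0

theorem primrecRel_seen : PrimrecRel Seen := by
  refine primrecPred_exists_lt (Primrec.list_length.comp Primrec.fst) (PrimrecPred.not
    (Primrec.eq.comp ((Primrec.list_getD 0).comp (Primrec.fst.comp Primrec.snd)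
      (primrec_digitIdx.comp (Primrec.snd.comp Primrec.snd) Primrec.fst)) (Primrec.const 0)))

theorem seen_initSeg_iff {p : Baire} {N k : ℕ} :
    Seen (initSeg p N) k ↔ ∃ m, digitIdx k m < N ∧ p (digitIdx k m) ≠ 0 := by
  constructor
  · rintro ⟨m, -, h⟩
    rcases lt_or_ge (digitIdx k m) N with hs | hs
    · rw [getD_initSeg _ _ hs] at h
      exact ⟨m, hs, h⟩
    · exact absurd (getD_initSeg_of_le _ _ hs) h
  · rintro ⟨m, hs, h⟩
    refine ⟨m, ?_, by rwa [getD_initSeg _ _ hs]⟩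
    rw [length_initSeg]
    exact (lt_digitIdx_right k m).trans hs

theorem Seen.mono {p : Baire} {N M k : ℕ} (h : Seen (initSeg p N) k) (hNM : N ≤ M) :
    Seen (initSeg p M) k := by
  rw [seen_initSeg_iff] at h ⊢
  obtain ⟨m, hm, hp⟩ := h
  exact ⟨m, hm.trans_le hNM, hp⟩

theorem Seen.exists_ne {p : Baire} {N k : ℕ} (h : Seen (initSeg p N) k) :
    ∃ m, p (digitIdx k m) ≠ 0 :=
  (seen_initSeg_iff.1 h).imp fun _ hm => hm.2

/-- Eventually all nonzero instances are seen. -/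
theorem exists_forall_seen (p : Baire) (n : ℕ) :
    ∃ N, ∀ M ≥ N, ∀ k < n, Seen (initSeg p M) k ↔ ∃ m, p (digitIdx k m) ≠ 0 := by
  have h : ∀ᶠ M in Filter.atTop, ∀ k ∈ Finset.range n,
      (Seen (initSeg p M) k ↔ ∃ m, p (digitIdx k m) ≠ 0) := by
    refine (Finset.eventually_all _).2 fun k _ => ?_
    by_cases hk : ∃ m, p (digitIdx k m) ≠ 0
    · obtain ⟨m, hm⟩ := hk
      filter_upwards [Filter.eventually_gt_atTop (digitIdx k m)] with M hM
      exact ⟨Seen.exists_ne, fun _ => seen_initSeg_iff.2 ⟨m, hM, hm⟩⟩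
    · exact Filter.Eventually.of_forall fun M => ⟨Seen.exists_ne, fun h => absurd h hk⟩
  obtain ⟨N, hN⟩ := Filter.eventually_atTop.1 h
  exact ⟨N, fun M hM k hk => hN M hM k (Finset.mem_range.2 hk)⟩

/-- The entries of a list at even positions. -/
def evens (u : List ℕ) : List ℕ :=
  (List.range ((u.length + 1) / 2)).map fun j => u.getD (2 * j) 0

theorem primrec_evens : Primrec evens := by
  refine Primrec.list_map (Primrec.list_range.comp (Primrec.nat_div.comp
    (Primrec.succ.comp Primrec.list_length) (Primrec.const 2))) ?_
  exact (Primrec.list_getD 0).comp Primrec.fst (Primrec.nat_double.comp Primrec.snd)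

theorem evens_initSeg_pairing (p q : Baire) (M : ℕ) :
    evens (initSeg (pairing p q) M) = initSeg p ((M + 1) / 2) := by
  rw [evens, length_initSeg]
  refine List.map_congr_left fun j hj => ?_
  have := List.mem_range.1 hj
  rw [getD_initSeg _ _ (by omega), pairing_even]

open Classical in
/-- The solution of an instance of `d_MLR × LPO*` obtained from a stage `u'` at which all nonzero
instances of `LPO` have been seen. The input is the even part of the sequence given by `u`. -/
noncomputable def readOff (u' u : List ℕ) (i : ℕ) : ℕ :=
  if i = 0 then 1 else
    if ∃ k < u'.getD 2 0, i = digitIdx k 0 ∧ Seen (evens u') k then 0 else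
      if ∃ k < u'.getD 2 0, i = digitIdx k 0 then 1 else u.getD (2 * i) 0

theorem primrec_readOff : Primrec fun z : List ℕ × List ℕ × ℕ => readOff z.1 z.2.1 z.2.2 := by
  classical
  have hi : Primrec fun z : List ℕ × List ℕ × ℕ => z.2.2 := Primrec.snd.comp Primrec.snd
  have hn : Primrec fun z : List ℕ × List ℕ × ℕ => z.1.getD 2 0 :=
    (Primrec.list_getD 0).comp Primrec.fst (Primrec.const 2)
  have hd : PrimrecPred fun z : ℕ × List ℕ × List ℕ × ℕ => z.2.2.2 = digitIdx z.1 0 :=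
    Primrec.eq.comp (hi.comp Primrec.snd) (primrec_digitIdx.comp Primrec.fst (Primrec.const 0))
  refine Primrec.ite (Primrec.eq.comp hi (Primrec.const 0)) (Primrec.const 1) (Primrec.ite
    (primrecPred_exists_lt hn (PrimrecPred.and hd (primrecRel_seen.comp (primrec_evens.comp
      (Primrec.fst.comp Primrec.snd)) Primrec.fst))) (Primrec.const 0) (Primrec.ite
    (primrecPred_exists_lt hn hd) (Primrec.const 1) ?_))
  exact (Primrec.list_getD 0).comp (Primrec.fst.comp Primrec.snd) (Primrec.nat_double.comp hi)

open Classical in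
/-- A canonical solution of the instance of `d_MLR × LPO*` named by `p`. -/
noncomputable def solution (p : Baire) (i : ℕ) : ℕ :=
  if i = 0 then 1 else
    if ∃ k < p 1, i = digitIdx k 0 ∧ ∃ m, p (digitIdx k m) ≠ 0 then 0 else
      if ∃ k < p 1, i = digitIdx k 0 then 1 else p i

theorem solves_solution (p : Baire) : Solves p (solution p) := by
  classical
  refine ⟨by rw [solution, if_pos rfl], ?_, fun k hk => ?_, fun m => ?_⟩
  · rw [solution, if_neg one_ne_zero, if_neg, if_neg]
    · rintro ⟨k, -, h⟩
      have := three_lt_digitIdx k 0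
      omega
    · rintro ⟨k, -, h, -⟩
      have := three_lt_digitIdx k 0
      omega
  · have := three_lt_digitIdx k 0
    rw [solution, if_neg (by omega)]
    by_cases h : ∃ m, p (digitIdx k m) ≠ 0
    · rw [if_pos ⟨k, hk, rfl, h⟩, if_neg (by push Not; exact h)]
    · have h1 : ¬ ∃ k' < p 1, digitIdx k 0 = digitIdx k' 0 ∧ ∃ m, p (digitIdx k' m) ≠ 0 := by
        rintro ⟨k', hk', he, hs⟩
        obtain rfl := digitIdx_inj he
        exact h hs
      have h2 : ∃ k' < p 1, digitIdx k 0 = digitIdx k' 0 := ⟨k, hk, rfl⟩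
      push Not at h
      rw [if_neg h1, if_pos h2, if_pos h]
  · rw [solution, if_neg (by simp [baseIdx]), if_neg, if_neg]
    · rintro ⟨k, hk, h⟩
      exact baseIdx_ne_digitIdx hk m h
    · rintro ⟨k, hk, h, -⟩
      exact baseIdx_ne_digitIdx hk m h

/-- Once the stage sees all nonzero instances, `readOff` produces the canonical `solution`. The
bound on `M` ensures that entry 2 of the pair, the number of instances, has been read. -/
theorem solves_readOff {p q r : Baire} {M : ℕ} (hM : 4 ≤ M)
    (hseen : ∀ k < p 1, Seen (initSeg p ((M + 1) / 2)) k ↔ ∃ m, p (digitIdx k m) ≠ 0)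
    (hr : ∀ i, r i = readOff (initSeg (pairing p q) M) (initSeg (pairing p q) (2 * i + 2)) i) :
    Solves p r := by
  have hn : (initSeg (pairing p q) M).getD 2 0 = p 1 := by
    rw [getD_initSeg _ _ (by omega), ← pairing_even p q]
  convert solves_solution p using 1
  funext i
  have hcopy : (initSeg (pairing p q) (2 * i + 2)).getD (2 * i) 0 = p i := by
    rw [getD_initSeg _ _ (by omega), pairing_even]
  rw [hr, readOff, solution, hn, evens_initSeg_pairing, hcopy]
  have e : (∃ k < p 1, i = digitIdx k 0 ∧ Seen (initSeg p ((M + 1) / 2)) k) ↔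
      ∃ k < p 1, i = digitIdx k 0 ∧ ∃ m, p (digitIdx k m) ≠ 0 :=
    exists_congr fun k => and_congr_right fun hk => and_congr_right fun _ => hseen k hk
  classical exact if_congr Iff.rfl rfl (if_congr e rfl rfl)

/-- The only discontinuity of `solution` lies in which instances are nonzero; where this pattern is
eventually constant, limits are preserved. -/
theorem eventually_solution_eq {X : Type} {l : Filter X} {f : X → Baire} {f₀ : Baire}
    (hf : ∀ i, ∀ᶠ x in l, f x i = f₀ i)
    (hd : ∀ᶠ x in l, ∀ k < f₀ 1, (∃ m, f x (digitIdx k m) ≠ 0) ↔ ∃ m, f₀ (digitIdx k m) ≠ 0)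
    (i : ℕ) : ∀ᶠ x in l, solution (f x) i = solution f₀ i := by
  filter_upwards [hf 1, hf i, hd] with x h1 hi hd
  rw [solution, solution, h1, hi]
  have e : (∃ k < f₀ 1, i = digitIdx k 0 ∧ ∃ m, f x (digitIdx k m) ≠ 0) ↔
      ∃ k < f₀ 1, i = digitIdx k 0 ∧ ∃ m, f₀ (digitIdx k m) ≠ 0 :=
    exists_congr fun k => and_congr_right fun hk => and_congr_right fun _ => hd k hk
  classical exact if_congr Iff.rfl rfl (if_congr e rfl rfl)

/-! ### `d_MLR × LPO*` reduces to hitting times -/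

open Classical in
/-- The number of elements of `{0, …, n - 1}` satisfying `p`. -/
noncomputable def countLT (p : ℕ → Prop) (n : ℕ) : ℕ :=
  ((List.range n).filter fun k => decide (p k)).length

theorem countLT_le (p : ℕ → Prop) (n : ℕ) : countLT p n ≤ n :=
  (List.length_filter_le _ _).trans_eq List.length_range

theorem countLT_mono {p q : ℕ → Prop} {n : ℕ} (h : ∀ k, p k → q k) : countLT p n ≤ countLT q n :=
  (List.monotone_filter_right _ (by simpa using h)).length_le

theorem countLT_congr {p q : ℕ → Prop} {n : ℕ} (h : ∀ k < n, p k ↔ q k) :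
    countLT p n = countLT q n := by
  rw [countLT, countLT, List.filter_congr]
  intro k hk
  simp [h k (List.mem_range.1 hk)]

/-- A subset of a finite set with the same number of elements is the whole set. This turns a count
into knowledge of which instances are nonzero. -/
theorem of_countLT_eq {p q : ℕ → Prop} {n : ℕ} (h : ∀ k, p k → q k)
    (he : countLT p n = countLT q n) : ∀ k < n, q k → p k := by
  classical
  intro k hk hq
  have hs := (List.monotone_filter_right (l := List.range n) (p := fun k => decide (p k))
    (q := fun k => decide (q k)) (by simpa using h)).eq_of_length he
  have : k ∈ (List.range n).filter fun k => decide (q k) := by simp [hk, hq]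
  rw [← hs] at this
  simpa using (List.mem_filter.1 this).2

theorem primrec_countLT_seen : Primrec fun z : List ℕ × ℕ => countLT (Seen z.1) z.2 := by
  classical
  refine Primrec.list_length.comp ((PrimrecRel.listFilter (R := fun k u => Seen u k)
    primrecRel_seen.swap).comp (Primrec.list_range.comp Primrec.snd) Primrec.fst)

/-- The prefix `u` of a name of a sequence shows that its first `n + 1` shifts differ on their
prefixes of length `l`. -/
def ShowsDistinct (u : List ℕ) (n l : ℕ) : Prop :=
  ∀ a < n + 1, ∀ b < n + 1, a ≠ b → evenWord u a l ≠ evenWord u b l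

theorem primrec_showsDistinct :
    PrimrecPred fun z : List ℕ × ℕ × ℕ => ShowsDistinct z.1 z.2.1 z.2.2 := by
  have hn : Primrec fun z : List ℕ × ℕ × ℕ => z.2.1 + 1 :=
    Primrec.succ.comp (Primrec.fst.comp Primrec.snd)
  refine primrecPred_forall_lt hn ?_
  refine primrecPred_forall_lt (Q := fun b (z : ℕ × List ℕ × ℕ × ℕ) => z.1 ≠ b →
    evenWord z.2.1 z.1 z.2.2.2 ≠ evenWord z.2.1 b z.2.2.2) (hn.comp Primrec.snd) ?_
  have ha : Primrec fun z : ℕ × ℕ × List ℕ × ℕ × ℕ => z.2.1 := Primrec.fst.comp Primrec.snd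
  have hu : Primrec fun z : ℕ × ℕ × List ℕ × ℕ × ℕ => z.2.2.1 :=
    Primrec.fst.comp (Primrec.snd.comp Primrec.snd)
  have hl : Primrec fun z : ℕ × ℕ × List ℕ × ℕ × ℕ => z.2.2.2.2 :=
    Primrec.snd.comp (Primrec.snd.comp (Primrec.snd.comp Primrec.snd))
  refine (PrimrecPred.or (Primrec.eq.comp ha Primrec.fst) (PrimrecPred.not (Primrec.eq.comp
    (primrec_evenWord.comp (Primrec.pair hu (Primrec.pair ha hl)))
    (primrec_evenWord.comp (Primrec.pair hu (Primrec.pair Primrec.fst hl)))))).of_eq fun z => ?_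
  exact or_iff_not_imp_left

open Classical in
/-- The open set that is first hit at time `n - c`, where `c` is the number of nonzero instances
of `LPO`. -/
noncomputable def countQuery (u : List ℕ) (i : ℕ) : ℕ :=
  if i % 2 = 0 then u.getD i 0 else
    if ShowsDistinct u (u.getD 1 0) (u.length / 2 - u.getD 1 0) then
      Encodable.encode (evenWord u (u.getD 1 0 - countLT (Seen u) (u.getD 1 0))
        (u.length / 2 - u.getD 1 0)) + 1
    else 0

theorem primrec_countQuery : Primrec₂ countQuery := by
  classical
  have hn : Primrec fun z : List ℕ × ℕ => z.1.getD 1 0 :=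
    (Primrec.list_getD 0).comp Primrec.fst (Primrec.const 1)
  have hl : Primrec fun z : List ℕ × ℕ => z.1.length / 2 - z.1.getD 1 0 :=
    Primrec.nat_sub.comp (Primrec.nat_div.comp (Primrec.list_length.comp Primrec.fst)
      (Primrec.const 2)) hn
  refine Primrec.ite (Primrec.eq.comp (Primrec.nat_mod.comp Primrec.snd (Primrec.const 2))
    (Primrec.const 0)) ((Primrec.list_getD 0).comp Primrec.fst Primrec.snd) (Primrec.ite
    (primrec_showsDistinct.comp (Primrec.pair Primrec.fst (Primrec.pair hn hl)))
    (Primrec.succ.comp (Primrec.encode.comp (primrec_evenWord.comp (Primrec.pair Primrec.fst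
      (Primrec.pair (Primrec.nat_sub.comp hn (primrec_countLT_seen.comp
        (Primrec.pair Primrec.fst hn))) hl))))) (Primrec.const 0))

theorem le_hittingTime :
    WReducible (mvProd (dMap MLR) (mvStar LPO)) HittingTime := by
  classical
  let PK : List ℕ → Prop := fun u => 4 ≤ u.length ∧
    countLT (Seen (evens u)) (u.getD 2 0) = u.getD 2 0 - u.getD 1 0
  have hPK : PrimrecPred PK := by
    have h2 : Primrec fun u : List ℕ => u.getD 2 0 :=
      (Primrec.list_getD 0).comp Primrec.id (Primrec.const 2)
    refine PrimrecPred.and (Primrec.nat_le.comp (Primrec.const 4) Primrec.list_length)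
      (Primrec.eq.comp (primrec_countLT_seen.comp (Primrec.pair primrec_evens h2))
        (Primrec.nat_sub.comp h2 ((Primrec.list_getD 0).comp Primrec.id (Primrec.const 1))))
  obtain ⟨H, hH, hHp⟩ := exists_computableBaire_synchronous primrec_countQuery
  refine ⟨staged PK readOff, H, computableBaire_staged hPK primrec_readOff, hH,
    fun G hG p z hz => ?_⟩
  obtain ⟨⟨x, hx⟩, w⟩ := z
  have hp : ∀ i, p (2 * i) = (x i).toNat := hz.1
  have hr := hHp p
  set r : Baire := fun i => countQuery (initSeg p (2 * i + 2)) i with hr_def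
  have hr0 : ∀ i, r (2 * i) = (x i).toNat := by
    intro i
    rw [hr_def]
    simp only [countQuery]
    rw [if_pos (by omega), getD_initSeg _ _ (by omega), hp]
  set n := p 1 with hn
  -- The prefix contains `2 * s + 2` bits of `x`; words of length `2 * s + 2 - n` can be read from
  -- each of the first n + 1 shifts.
  have hword : ∀ s a, a ≤ n → evenWord (initSeg p (2 * (2 * s + 1) + 2)) a (2 * s + 2 - n) =
      initSeg (shift^[a] x) (2 * s + 2 - n) := fun s a ha =>
    evenWord_initSeg hp fun h => by omega
  set cnt : ℕ → ℕ := fun s => countLT (Seen (initSeg p (2 * (2 * s + 1) + 2))) n with hcnt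
  set Dist : ℕ → Prop := fun l => ∀ a ≤ n, ∀ b ≤ n, a ≠ b →
    initSeg (shift^[a] x) l ≠ initSeg (shift^[b] x) l with hDist
  have hr1 : ∀ s, r (2 * s + 1) = if Dist (2 * s + 2 - n) then
      Encodable.encode (initSeg (shift^[n - cnt s] x) (2 * s + 2 - n)) + 1 else 0 := by
    intro s
    have h1 : (initSeg p (2 * (2 * s + 1) + 2)).getD 1 0 = n := getD_initSeg _ _ (by omega)
    have h2 : (2 * (2 * s + 1) + 2) / 2 = 2 * s + 2 := by omega
    have h3 : ShowsDistinct (initSeg p (2 * (2 * s + 1) + 2)) n (2 * s + 2 - n) ↔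
        Dist (2 * s + 2 - n) := by
      simp only [ShowsDistinct, hDist, Nat.lt_succ_iff]
      refine forall₂_congr fun a ha => forall₂_congr fun b hb => ?_
      rw [hword s a ha, hword s b hb]
    rw [hr_def]
    simp only [countQuery]
    rw [if_neg (by omega), h1, length_initSeg, h2, hword s _ (Nat.sub_le _ _)]
    exact if_congr h3 rfl rfl
  let c := countLT (fun k => ∃ m, p (digitIdx k m) ≠ 0) n
  have hcn : c ≤ n := countLT_le _ _
  have hcs : ∀ s, cnt s ≤ c := fun s => countLT_mono fun k => Seen.exists_ne
  obtain ⟨N, hN⟩ := exists_forall_seen p n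
  have hdist : ∃ l₀, ∀ l ≥ l₀, Dist l := by
    have h : ∀ᶠ l in Filter.atTop, ∀ a ∈ Finset.range (n + 1), ∀ b ∈ Finset.range (n + 1),
        a ≠ b → initSeg (shift^[a] x) l ≠ initSeg (shift^[b] x) l := by
      refine (Finset.eventually_all _).2 fun a _ => (Finset.eventually_all _).2 fun b _ => ?_
      by_cases hab : a = b
      · simp [hab]
      · obtain ⟨i, hi⟩ := Function.ne_iff.1 ((shift_iterate_injective hx).ne hab)
        filter_upwards [Filter.eventually_gt_atTop i] with l hl _ he
        exact hi (initSeg_eq_iff.1 he i hl)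
    obtain ⟨l₀, hl₀⟩ := Filter.eventually_atTop.1 h
    exact ⟨l₀, fun l hl a ha b hb => hl₀ l hl a (Finset.mem_range.2 (by omega)) b
      (Finset.mem_range.2 (by omega))⟩
  obtain ⟨l₀, hl₀⟩ := hdist
  have hmem : shift^[n - c] x ∈ enumeratedOpen (sndPart r) := by
    let s := N + l₀ + n
    have hc : cnt s = c := countLT_congr (hN _ (by omega))
    refine ⟨s, 2 * s + 2 - n, ?_⟩
    rw [sndPart, hr1, if_pos (hl₀ _ (by omega)), hc]
  -- Every listed word is a prefix of a shift at time `n - cnt s`, which is at least `n - c`, and is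
  -- long enough to separate it from all other shifts up to time n. So no earlier shift is captured.
  have hleast : IsLeast {m | shift^[m] x ∈ enumeratedOpen (sndPart r)} (n - c) := by
    refine ⟨hmem, ?_⟩
    rintro m ⟨s, l, hl⟩
    by_contra! hlt
    rw [sndPart, hr1] at hl
    split_ifs at hl with hd
    · have he : initSeg (shift^[n - cnt s] x) (2 * s + 2 - n) = initSeg (shift^[m] x) l :=
        Encodable.encode_injective (by omega)
      have hll : 2 * s + 2 - n = l := by simpa using congrArg List.length he
      rw [← hll] at he
      have := hcs s
      exact hd _ (Nat.sub_le _ _) m (by omega) (by omega) he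
  obtain ⟨t, ht, y, hy, hty⟩ := hG r ⟨⟨x, hx⟩, ⟨⟨enumeratedOpen (sndPart r),
    isOpen_enumeratedOpen _⟩, ⟨_, hmem⟩⟩⟩ ⟨hr0, rfl⟩
  have ht0 : t 0 = n - c := by
    have hty : t 0 = y := hty
    rw [hty]
    exact hy.unique hleast
  have hget : ∀ M, 4 ≤ M → (PK (initSeg (pairing p t) M) ↔
      countLT (Seen (initSeg p ((M + 1) / 2))) n = c) := by
    intro M hM
    simp only [PK, length_initSeg, evens_initSeg_pairing]
    rw [getD_initSeg _ _ (by omega), getD_initSeg _ _ (by omega),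
      show pairing p t 2 = n from pairing_even p t 1,
      show pairing p t 1 = t 0 from pairing_odd p t 0, ht0, Nat.sub_sub_self hcn]
    exact and_iff_right hM
  have hex : ∃ M, PK (initSeg (pairing p t) M) := by
    refine ⟨2 * N + 4, (hget _ (by omega)).2 (countLT_congr (hN _ (by omega)))⟩
  obtain ⟨q, hq⟩ := exists_mem_staged readOff hex
  obtain ⟨M, ⟨hM, -⟩, hqi⟩ := mem_staged.1 hq
  have hM4 : 4 ≤ M := by simpa using hM.1
  refine ⟨q, Part.mem_bind hr (Part.mem_bind ht hq), (exists_mem_dMap_prod_star_iff hz).2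
    (solves_readOff hM4 (fun k hk => ⟨Seen.exists_ne, ?_⟩) hqi)⟩
  exact of_countLT_eq (fun k => Seen.exists_ne) ((hget M hM4).1 hM) k hk


/-! ### `d_MLR × LPO*` reduces to layers -/

section Layers

variable (R : ℕ → List Bool → ℕ → Prop)

/-- Within `s` steps, `w` is seen to have a prefix enumerated into the `j`-th open set. -/
def Certified (j : ℕ) (w : List Bool) (s : ℕ) : Prop :=
  ∃ s' < s, ∃ n < w.length + 1, R j (w.take n) s'

/-- For every prefix of the instance `v` at which some nonzero instance of `LPO` seen in `v` is
not yet seen, the output `w` has been certified to lie in the level given by its length. -/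
def CopyAllowed (v : List ℕ) (s : ℕ) (w : List Bool) : Prop :=
  ∀ j < v.length + 1, Certified R j w s ∨ ∀ k < v.getD 1 0, Seen v k → Seen (v.take j) k

open Classical in
/-- The next output bit: a copy of the input bit if this is allowed, and zero otherwise. -/
noncomputable def layerBit (v : List ℕ) (s : ℕ) (w : List Bool) : Bool :=
  decide (CopyAllowed R v s w ∧ v.getD (2 * s) 0 ≠ 0)

/-- The first `s` output bits. -/
noncomputable def layerWord (u : List ℕ) (s : ℕ) : List Bool :=
  Nat.rec [] (fun s w => w ++ [layerBit R (u.take (2 * s + 2)) s w]) s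

/-- The sequence of all output bits. -/
noncomputable def layerSeq (p : Baire) : Cantor := fun s =>
  layerBit R (initSeg p (2 * s + 2)) s (layerWord R (initSeg p (2 * s + 2)) s)

variable {R}

theorem primrec_copyAllowed (hR : PrimrecPred fun z : ℕ × List Bool × ℕ => R z.1 z.2.1 z.2.2) :
    PrimrecPred fun z : List ℕ × ℕ × List Bool => CopyAllowed R z.1 z.2.1 z.2.2 := by
  have hC : PrimrecPred fun z : ℕ × List Bool × ℕ => Certified R z.1 z.2.1 z.2.2 := by
    refine primrecPred_exists_lt (Primrec.snd.comp Primrec.snd) ?_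
    have hw : Primrec fun z : ℕ × ℕ × List Bool × ℕ => z.2.2.1 :=
      Primrec.fst.comp (Primrec.snd.comp Primrec.snd)
    refine primrecPred_exists_lt (Q := fun n (z : ℕ × ℕ × List Bool × ℕ) =>
      R z.2.1 (z.2.2.1.take n) z.1) (Primrec.succ.comp (Primrec.list_length.comp hw)) ?_
    exact hR.comp (Primrec.pair (Primrec.fst.comp (Primrec.snd.comp Primrec.snd))
      (Primrec.pair (Primrec.list_take.comp Primrec.fst (hw.comp Primrec.snd))
        (Primrec.fst.comp Primrec.snd)))
  refine primrecPred_forall_lt (Primrec.succ.comp (Primrec.list_length.comp Primrec.fst)) ?_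
  refine PrimrecPred.or (hC.comp (Primrec.pair Primrec.fst (Primrec.pair
    (Primrec.snd.comp (Primrec.snd.comp Primrec.snd))
    (Primrec.fst.comp (Primrec.snd.comp Primrec.snd))))) ?_
  have hv : Primrec fun z : ℕ × List ℕ × ℕ × List Bool => z.2.1 := Primrec.fst.comp Primrec.snd
  refine primrecPred_forall_lt (Q := fun k (z : ℕ × List ℕ × ℕ × List Bool) =>
    Seen z.2.1 k → Seen (z.2.1.take z.1) k) ((Primrec.list_getD 0).comp hv (Primrec.const 1)) ?_
  refine (PrimrecPred.or (PrimrecPred.not (primrecRel_seen.comp (hv.comp Primrec.snd) Primrec.fst))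
    (primrecRel_seen.comp (Primrec.list_take.comp (Primrec.fst.comp Primrec.snd)
      (hv.comp Primrec.snd)) Primrec.fst)).of_eq fun z => ?_
  exact imp_iff_not_or.symm

theorem primrec_layerBit (hR : PrimrecPred fun z : ℕ × List Bool × ℕ => R z.1 z.2.1 z.2.2) :
    Primrec fun z : List ℕ × ℕ × List Bool => layerBit R z.1 z.2.1 z.2.2 := by
  classical
  refine PrimrecPred.decide (PrimrecPred.and (primrec_copyAllowed hR) (PrimrecPred.not
    (Primrec.eq.comp ((Primrec.list_getD 0).comp Primrec.fst (Primrec.nat_double.comp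
      (Primrec.fst.comp Primrec.snd))) (Primrec.const 0))))

theorem primrec_layerWord (hR : PrimrecPred fun z : ℕ × List Bool × ℕ => R z.1 z.2.1 z.2.2) :
    Primrec₂ (layerWord R) := by
  refine Primrec.nat_rec (f := fun _ : List ℕ => ([] : List Bool))
    (g := fun u z => z.2 ++ [layerBit R (u.take (2 * z.1 + 2)) z.1 z.2]) (Primrec.const []) ?_
  have hs : Primrec fun z : List ℕ × ℕ × List Bool => z.2.1 := Primrec.fst.comp Primrec.snd
  have hw : Primrec fun z : List ℕ × ℕ × List Bool => z.2.2 := Primrec.snd.comp Primrec.snd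
  exact Primrec.list_concat.comp hw ((primrec_layerBit hR).comp (Primrec.pair
    (Primrec.list_take.comp (Primrec.succ.comp (Primrec.succ.comp (Primrec.nat_double.comp hs)))
      Primrec.fst) (Primrec.pair hs hw)))

theorem layerWord_congr (p : Baire) {s M M' : ℕ} (h : 2 * s ≤ M) (h' : 2 * s ≤ M') :
    layerWord R (initSeg p M) s = layerWord R (initSeg p M') s := by
  induction s with
  | zero => rfl
  | succ s ih =>
    change layerWord R (initSeg p M) s ++ [layerBit R _ s (layerWord R (initSeg p M) s)] =
      layerWord R (initSeg p M') s ++ [layerBit R _ s (layerWord R (initSeg p M') s)]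
    rw [ih (by omega) (by omega), take_initSeg p (by omega), take_initSeg p (by omega)]

theorem layerWord_initSeg (p : Baire) {s M : ℕ} (h : 2 * s ≤ M) :
    layerWord R (initSeg p M) s = initSeg (layerSeq R p) s := by
  induction s with
  | zero => rfl
  | succ s ih =>
    change layerWord R (initSeg p M) s ++ [layerBit R _ s (layerWord R (initSeg p M) s)] = _
    rw [initSeg_concat, ← ih (by omega), take_initSeg p (by omega), layerSeq,
      layerWord_congr p (M := 2 * s + 2) (M' := M) (by omega) (by omega)]

theorem layerSeq_eq (p : Baire) (s : ℕ) : layerSeq R p s =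
    layerBit R (initSeg p (2 * s + 2)) s (initSeg (layerSeq R p) s) := by
  rw [layerSeq, layerWord_initSeg p (by omega)]

theorem certified_initSeg_iff {x : Cantor} {j s : ℕ} :
    Certified R j (initSeg x s) s ↔ ∃ s' < s, ∃ n ≤ s, R j (initSeg x n) s' := by
  simp only [Certified, length_initSeg, Nat.lt_succ_iff]
  refine exists_congr fun s' => and_congr_right fun _ => exists_congr fun n =>
    and_congr_right fun hn => ?_
  rw [take_initSeg x hn]

variable {U : ℕ → TopologicalSpace.Opens Cantor} {p : Baire} {x : Cantor}

/-- A non-random output lies in all levels. The finitely many `j < N` are then certified eventually,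
and any `j ≥ N` is a correct bound, so from some point on every bit is copied from the random `x`.
-/
theorem layerSeq_mem_MLR (hU : IsUniversalMLTest U)
    (hRU : ∀ i x, x ∈ U i ↔ ∃ n s, R i (initSeg x n) s) (hx : x ∈ MLR)
    (hp : ∀ i, p (2 * i) = (x i).toNat) : layerSeq R p ∈ MLR := by
  by_contra hr
  obtain ⟨N, hN⟩ := exists_forall_seen p (p 1)
  have hc : ∀ᶠ s in Filter.atTop, ∀ j ∈ Finset.range N,
      Certified R j (initSeg (layerSeq R p) s) s := by
    refine (Finset.eventually_all _).2 fun j _ => ?_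
    obtain ⟨n, s', h⟩ := (hRU j _).1 (mem_of_not_mem_MLR hU hr j)
    filter_upwards [Filter.eventually_gt_atTop s', Filter.eventually_ge_atTop n] with s h1 h2
    exact certified_initSeg_iff.2 ⟨s', h1, n, h2, h⟩
  obtain ⟨S, hS⟩ := Filter.eventually_atTop.1 hc
  refine hr (mem_MLR_of_eventually_eq hx (m := S) fun s hs => ?_)
  have hcopy : CopyAllowed R (initSeg p (2 * s + 2)) s (initSeg (layerSeq R p) s) := by
    intro j hj
    rw [length_initSeg] at hj
    by_cases hjN : j < N
    · exact Or.inl (hS s hs j (Finset.mem_range.2 hjN))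
    · refine Or.inr fun k hk hseen => ?_
      rw [getD_initSeg _ _ (by omega)] at hk
      rw [take_initSeg p (by omega)]
      exact (hN j (by omega) k hk).2 hseen.exists_ne
  rw [layerSeq_eq, layerBit, getD_initSeg _ _ (by omega), hp]
  cases x s <;> simp [hcopy]

/-- If `j` were too small a bound, it would never be certified and would block copying as soon as
instance `k` is seen. The output would end in zeros, hence lie in every level, including `U j`. -/
theorem seen_of_layerSeq_not_mem (hU : IsUniversalMLTest U)
    (hRU : ∀ i x, x ∈ U i ↔ ∃ n s, R i (initSeg x n) s) {j : ℕ} (hj : layerSeq R p ∉ U j)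
    {k : ℕ} (hk : k < p 1) (hne : ∃ m, p (digitIdx k m) ≠ 0) : Seen (initSeg p j) k := by
  by_contra hns
  obtain ⟨N, hN⟩ := exists_forall_seen p (p 1)
  refine hj (mem_of_not_mem_MLR hU (not_mem_MLR_of_eventually_false (m := N + j) fun s hs => ?_) j)
  have hcopy : ¬ CopyAllowed R (initSeg p (2 * s + 2)) s (initSeg (layerSeq R p) s) := by
    intro h
    rcases h j (by rw [length_initSeg]; omega) with h | h
    · obtain ⟨s', -, n, -, h⟩ := certified_initSeg_iff.1 h
      exact hj ((hRU j _).2 ⟨n, s', h⟩)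
    · rw [take_initSeg p (by omega), getD_initSeg _ _ (by omega)] at h
      exact hns (h k hk ((hN _ (by omega) k hk).2 hne))
  rw [layerSeq_eq, layerBit]
  simp [hcopy]

end Layers

theorem le_LAY {U : ℕ → TopologicalSpace.Opens Cantor} (hU : IsUniversalMLTest U) :
    WReducible (mvProd (dMap MLR) (mvStar LPO)) (LAY U) := by
  obtain ⟨R, hR, hRU⟩ := exists_primrec_of_isComputable hU.1.1
  -- Entry 1 of the pair is the layer j; the even half of a prefix of length M contains (M + 1) / 2
  -- digits of the instance, so this waits until j of them are present.
  let PK : List ℕ → Prop := fun u => 4 ≤ u.length ∧ u.getD 1 0 ≤ (u.length + 1) / 2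
  have hPK : PrimrecPred PK :=
    PrimrecPred.and (Primrec.nat_le.comp (Primrec.const 4) Primrec.list_length)
      (Primrec.nat_le.comp ((Primrec.list_getD 0).comp Primrec.id (Primrec.const 1))
        (Primrec.nat_div.comp (Primrec.succ.comp Primrec.list_length) (Primrec.const 2)))
  let φ : List ℕ → ℕ → ℕ := fun u i => (layerBit R u i (layerWord R u i)).toNat
  have hφ : Primrec₂ φ := (Primrec.dom_bool Bool.toNat).comp ((primrec_layerBit hR).comp
    (Primrec.pair Primrec.fst (Primrec.pair Primrec.snd
      ((primrec_layerWord hR).comp Primrec.fst Primrec.snd))))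
  obtain ⟨H, hH, hHp⟩ := exists_computableBaire_synchronous hφ
  refine ⟨staged PK readOff, H, computableBaire_staged hPK primrec_readOff, hH,
    fun G hG p z hz => ?_⟩
  obtain ⟨⟨x, hx⟩, w⟩ := z
  have hp : ∀ i, p (2 * i) = (x i).toNat := hz.1
  obtain ⟨t, ht, j, hj, htj⟩ := hG _ ⟨layerSeq R p, layerSeq_mem_MLR hU hRU hx hp⟩
    (fun i => rfl : Represented.IsName (fun i => φ (initSeg p (2 * i + 2)) i) (layerSeq R p))
  have htj : t 0 = j := htj
  have hget : ∀ M, 4 ≤ M → (PK (initSeg (pairing p t) M) ↔ j ≤ (M + 1) / 2) := by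
    intro M hM
    simp only [PK, length_initSeg]
    rw [getD_initSeg _ _ (by omega), show pairing p t 1 = t 0 from pairing_odd p t 0, htj]
    exact and_iff_right hM
  obtain ⟨q, hq⟩ := exists_mem_staged readOff (P := PK) (p := pairing p t)
    ⟨2 * j + 4, (hget _ (by omega)).2 (by omega)⟩
  obtain ⟨M, ⟨hM, -⟩, hqi⟩ := mem_staged.1 hq
  have hM4 : 4 ≤ M := by simpa using hM.1
  refine ⟨q, Part.mem_bind (hHp p) (Part.mem_bind ht hq), (exists_mem_dMap_prod_star_iff hz).2
    (solves_readOff hM4 (fun k hk => ⟨Seen.exists_ne, fun hne => ?_⟩) hqi)⟩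
  exact (seen_of_layerSeq_not_mem hU hRU hj hk hne).mono ((hget M hM4).1 hM)

/-! ### Negative results -/

theorem eventually_pairing_eq {X : Type} {l : Filter X} {f g : X → Baire} {f₀ g₀ : Baire}
    (hf : ∀ i, ∀ᶠ x in l, f x i = f₀ i) (hg : ∀ i, ∀ᶠ x in l, g x i = g₀ i) (i : ℕ) :
    ∀ᶠ x in l, pairing (f x) (g x) i = pairing f₀ g₀ i := by
  filter_upwards [hf (i / 2), hg (i / 2)] with x h1 h2
  simp only [pairing, h1, h2]

theorem not_LAY_le {U : ℕ → TopologicalSpace.Opens Cantor} (hU : IsUniversalMLTest U) :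
    ¬ WReducible (LAY U) (mvProd (dMap MLR) (mvStar LPO)) := by
  rintro ⟨K, H, hK, hH, h⟩
  let nm : MLR → Baire := fun x i => ((x : Cantor) i).toNat
  have hex : ∀ x : MLR, ∃ r s, r ∈ H (nm x) ∧ s ∈ K (pairing (nm x) (solution r)) ∧
      (x : Cantor) ∉ U (s 0) := by
    intro x
    -- Fixing one explicit realizer makes everything a function of the canonical name of `x`.
    obtain ⟨s, hs, y, hy, hsy⟩ := h (fun p => Part.some (solution p))
      (realizes_dMap_prod_star_iff.2 fun p _ _ _ => ⟨_, Part.mem_some _, solves_solution p⟩)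
      (nm x) x fun _ => rfl
    obtain ⟨r, hr, hs⟩ := Part.mem_bind_iff.1 hs
    rw [Part.bind_some] at hs
    have hsy : s 0 = y := hsy
    exact ⟨r, s, hr, hs, hsy ▸ hy⟩
  choose r s hr hs hsU using hex
  have hnm : ∀ (x₁ : MLR) i, ∀ᶠ x in nhds x₁, nm x i = nm x₁ i := by
    intro x₁ i
    have hc : Continuous fun x : MLR => (x : Cantor) i :=
      (continuous_apply i).comp continuous_subtype_val
    filter_upwards [hc.continuousAt.preimage_mem_nhds
      ((isOpen_discrete {(x₁ : Cantor) i}).mem_nhds rfl)] with x hx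
    have hx : (x : Cantor) i = (x₁ : Cantor) i := hx
    simp only [nm, hx]
  have hrc : ∀ (x₁ : MLR) i, ∀ᶠ x in nhds x₁, r x i = r x₁ i := fun x₁ =>
    hH.eventually_eq (hnm x₁) (Filter.Eventually.of_forall hr) (hr x₁)
  obtain ⟨x₀, hx₀, -⟩ := exists_mem_MLR_not_mem hU
  set n := r ⟨x₀, hx₀⟩ 1 with hn
  let ne : MLR → ℕ → Prop := fun x k => k < n ∧ ∃ m, r x (digitIdx k m) ≠ 0
  -- Fixing the number n of instances bounds the counts, so a maximum is attained. Near a maximiser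
  -- `x₁` nonzero instances stay nonzero, and maximality forbids new ones.
  let C : Set ℕ := {c | ∃ x, r x 1 = n ∧ countLT (ne x) n = c}
  have hbdd : BddAbove C := ⟨n, by rintro _ ⟨x, -, rfl⟩; exact countLT_le _ _⟩
  obtain ⟨x₁, hx₁, hmax⟩ := Nat.sSup_mem (s := C) ⟨_, ⟨x₀, hx₀⟩, hn.symm, rfl⟩ hbdd
  have hne : ∀ᶠ x in nhds x₁, ∀ k ∈ Finset.range n, ne x₁ k → ne x k := by
    refine (Finset.eventually_all _).2 fun k _ => ?_
    by_cases hk : ne x₁ k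
    · obtain ⟨hkn, m, hm⟩ := hk
      filter_upwards [hrc x₁ (digitIdx k m)] with x hx _
      exact ⟨hkn, m, by rwa [hx]⟩
    · exact Filter.Eventually.of_forall fun x h => absurd h hk
  have hconst : ∀ᶠ x in nhds x₁, ∀ k < r x₁ 1,
      (∃ m, r x (digitIdx k m) ≠ 0) ↔ ∃ m, r x₁ (digitIdx k m) ≠ 0 := by
    filter_upwards [hne, hrc x₁ 1] with x hx h1 k hk
    have hx : ∀ k, ne x₁ k → ne x k := fun k hk => hx k (Finset.mem_range.2 hk.1) hk
    have hle : countLT (ne x) n ≤ countLT (ne x₁) n := by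
      rw [hmax]
      exact le_csSup hbdd ⟨x, h1.trans hx₁, rfl⟩
    have heq := of_countLT_eq hx (le_antisymm (countLT_mono hx) hle)
    rw [hx₁] at hk
    exact ⟨fun hm => (heq k hk ⟨hk, hm⟩).2, fun hm => (hx k ⟨hk, hm⟩).2⟩
  have hs0 := hK.eventually_eq
    (eventually_pairing_eq (hnm x₁) (eventually_solution_eq (hrc x₁) hconst))
    (Filter.Eventually.of_forall hs) (hs x₁) 0
  obtain ⟨O, hO, hsub⟩ := mem_nhds_subtype _ _ _ |>.1 hs0
  obtain ⟨O', hO', hopen, hx₁O⟩ := mem_nhds_iff.1 hO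
  obtain ⟨z, hz, hzO, hzU⟩ := exists_mem_MLR_inter hU (s x₁ 0) x₁.2 hopen hx₁O
  have hzs : s ⟨z, hz⟩ 0 = s x₁ 0 := hsub (a := ⟨z, hz⟩) (hO' hzO)
  exact hsU ⟨z, hz⟩ (hzs ▸ hzU)

/-- Level 1 has measure at most 1/2, so some random `x` lies outside it; on this single `x` the
hitting time is discontinuous in the open set. -/
theorem not_stronglyLayerwiseComputable_hittingTime {U : ℕ → TopologicalSpace.Opens Cantor}
    (hU : IsUniversalMLTest U) : ¬ StronglyLayerwiseComputable U HittingTime := by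
  intro h
  obtain ⟨F, hF, hFr⟩ := h 1
  obtain ⟨x, hx, hxU⟩ := exists_mem_MLR_not_mem hU
  let nm : Baire := fun i => (x i).toNat
  have key : ∀ e : Baire, (enumeratedOpen e).Nonempty →
      ∃ q ∈ F (pairing nm e), IsLeast {m | shift^[m] x ∈ enumeratedOpen e} (q 0) := by
    intro e he
    obtain ⟨q, hq, y, hy, hqy⟩ := hFr (pairing nm e)
      ⟨(⟨x, hx⟩, ⟨⟨enumeratedOpen e, isOpen_enumeratedOpen e⟩, he⟩), hxU⟩
      ⟨fun i => pairing_even nm e i, congrArg enumeratedOpen (sndPart_pairing nm e)⟩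
    have hqy : q 0 = y := hqy
    exact ⟨q, hq, hqy ▸ hy⟩
  -- At position i the sequences `x` and `shift x` differ, so the cylinder coded by `a` contains
  -- `shift x` but not `x`. Replacing entry t of the constant enumeration `a` by `b` adds `x` and
  -- drops the hitting time to 0, while the names converge as t grows.
  obtain ⟨i, hi⟩ := Function.ne_iff.1 ((shift_iterate_injective hx).ne one_ne_zero)
  have hi : shift x i ≠ x i := hi
  let a := Encodable.encode (initSeg (shift x) (i + 1)) + 1
  let b := Encodable.encode (initSeg x (i + 1)) + 1
  obtain ⟨q₀, hq₀, hl₀⟩ := key (fun _ => a) ⟨shift x, 0, i + 1, rfl⟩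
  choose q hq hl using fun t => key (fun m => if m = t then b else a)
    ⟨x, t, i + 1, if_pos rfl⟩
  have hcont := hF.eventually_eq (l := Filter.atTop) (f := fun t => pairing nm fun m =>
      if m = t then b else a) (f₀ := pairing nm fun _ => a)
    (eventually_pairing_eq (fun _ => Filter.Eventually.of_forall fun _ => rfl) fun m => by
      filter_upwards [Filter.eventually_gt_atTop m] with t ht
      rw [if_neg ht.ne]) (Filter.Eventually.of_forall hq) hq₀ 0
  obtain ⟨t, ht⟩ := hcont.exists
  have h0 : q t 0 = 0 := Nat.le_zero.1 ((hl t).2 ⟨t, i + 1, if_pos rfl⟩)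
  have hmem := hl₀.1
  rw [← ht, h0] at hmem
  obtain ⟨m, l, hm⟩ := hmem
  have he : initSeg (shift x) (i + 1) = initSeg x l :=
    Encodable.encode_injective (Nat.succ_injective hm)
  obtain rfl : i + 1 = l := by simpa using congrArg List.length he
  exact hi (initSeg_eq_iff.1 he i (Nat.lt_succ_self i))

end TTE

theorem theorem35 :
    TTE.WEquiv TTE.HittingTime (TTE.mvProd (TTE.dMap TTE.MLR) (TTE.mvStar TTE.LPO)) ∧
    ∀ U : ℕ → TopologicalSpace.Opens TTE.Cantor, TTE.IsUniversalMLTest U →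
      TTE.WStrict (TTE.mvProd (TTE.dMap TTE.MLR) (TTE.mvStar TTE.LPO)) (TTE.LAY U) ∧
      ¬ TTE.StronglyLayerwiseComputable U TTE.HittingTime :=
  ⟨⟨TTE.hittingTime_le, TTE.le_hittingTime⟩, fun _ hU =>
    ⟨⟨TTE.le_LAY hU, TTE.not_LAY_le hU⟩, TTE.not_stronglyLayerwiseComputable_hittingTime hU⟩⟩
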